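/- **Theorem (Identification of the metastable state).** Let $q>2$ and $K,L\ge 1$ be integers and let $\Lambda=(V,E)$ be the $K\times L$ grid graph with periodic boundary conditions (the discrete torus), $V=\{0,\dots,K-1\}\times\{0,\dots,L-1\}$. Let $\mathcal X=\{1,\dots,q\}^V$ and, for $0<h<1$, let $$H(\sigma)=-\sum_{\{v,w\}\in E}\mathbf 1_{\{\sigma(v)=\sigma(w)\}}+h\sum_{u\in V}\mathbf 1_{\{\sigma(u)=1\}},\qquad \sigma\in\mathcal X,$$ be the Hamiltonian of the $q$-state Potts model with negative external field $-h$. A path from $\sigma$ to $\sigma'$ is a finite sequence $\omega=(\omega_0,\dots,\omega_n)$ in $\mathcal X$, $n\ge 0$, with $\omega_0=\sigma$, $\omega_n=\sigma'$, in which consecutive configurations differ at exactly one vertex. Put $$\Phi(\sigma,\sigma')=\min_{\omega:\sigma\to\sigma'}\ \max_{i} H(\omega_i),\qquad \Phi(\sigma,\mathcal A)=\min_{\sigma'\in\mathcal A}\Phi(\sigma,\sigma'),\qquad \Gamma(\sigma,\mathcal A)=\Phi(\sigma,\mathcal A)-H(\sigma)$$ for non-empty $\mathcal A\subseteq\mathcal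 X$. The stability level of $\sigma$ is $V_\sigma=\Gamma(\sigma,\mathcal I_\sigma)$ with $\mathcal I_\sigma=\{\eta\in\mathcal X: H(\eta)<H(\sigma)\}$, and $V_\sigma=\infty$ if $\mathcal I_\sigma=\varnothing$. Let $\mathcal X^s$ be the set of global minimizers of $H$ (the stable states) and let $$\mathcal X^m=\Big\{\eta\in\mathcal X:\ V_\eta=\max_{\sigma\in\mathcal X\setminus\mathcal X^s}V_\sigma\Big\}$$ be the set of metastable states. Let $\ell^*=\lceil 2/h\rceil$, and assume that $2/h$ is not an integer and that $L\ge K\ge 3\ell^*$. Then the only metastable state is the configuration $\mathbf 1$ with all spins equal to $1$, $$\mathcal X^m=\{\mathbf 1\},$$ and its stability level is $$V_{\mathbf 1}=\Gamma(\mathbf 1,\mathcal X^s)=4\ell^*-h\big(\ell^*(\ell^*-1)+1\big).$$ -/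

import Mathlib

noncomputable section

/-! ### Energy landscapes `(X, H, Q)` -/

namespace Landscape

/-- A path `ω₀, …, ωₙ` from `σ` to `σ'`: consecutive states are connected by `Q`. -/
structure Path {X : Type*} (Q : X → X → ℝ) (σ σ' : X) where
  length : ℕ
  state : Fin (length + 1) → X
  source : state 0 = σ
  target : state (Fin.last length) = σ'
  step : ∀ i : Fin length, 0 < Q (state i.castSucc) (state i.succ)

/-- The height `max_i H(ωᵢ)` of a path. -/
def Path.height {X : Type*} {Q : X → X → ℝ} {σ σ' : X} (H : X → ℝ) (ω : Path Q σ σ') : ℝ :=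
  Finset.univ.sup' ⟨0, Finset.mem_univ 0⟩ (fun i => H (ω.state i))

/-- The communication height `Φ(σ, σ')`, the minimal height of a path from `σ` to `σ'`.
On a finite `X` the heights take finitely many values, so the infimum is a minimum; it is `⊤`
when there is no path. -/
def commHeight {X : Type*} (H : X → ℝ) (Q : X → X → ℝ) (σ σ' : X) : EReal :=
  ⨅ ω : Path Q σ σ', (ω.height H : EReal)

/-- The communication height `Φ(A, B) = min_{σ ∈ A, σ' ∈ B} Φ(σ, σ')` between two sets. -/
def commHeightSet {X : Type*} (H : X → ℝ) (Q : X → X → ℝ) (A B : Set X) : EReal :=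
  ⨅ σ ∈ A, ⨅ σ' ∈ B, commHeight H Q σ σ'

/-- The energy barrier `Γ(σ, A) = Φ(σ, A) - H(σ)`. -/
def barrier {X : Type*} (H : X → ℝ) (Q : X → X → ℝ) (σ : X) (A : Set X) : EReal :=
  commHeightSet H Q {σ} A - (H σ : EReal)

/-- The states of energy strictly below that of `σ`. -/
def lowerStates {X : Type*} (H : X → ℝ) (σ : X) : Set X := {η | H η < H σ}

/-- The stability level `V_σ = Φ(σ, I_σ) - H(σ)`, where `I_σ` is the set of states of energy
strictly below `H(σ)`; it is `⊤` when `I_σ` is empty (an infimum over the empty set). -/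
def stabilityLevel {X : Type*} (H : X → ℝ) (Q : X → X → ℝ) (σ : X) : EReal :=
  barrier H Q σ (lowerStates H σ)

/-- The bottom of a set: the minimizers of `H` on it. -/
def bottom {X : Type*} (H : X → ℝ) (A : Set X) : Set X := {η | η ∈ A ∧ ∀ σ ∈ A, H η ≤ H σ}

/-- The stable states: the global minimizers of `H`. -/
def stableStates {X : Type*} (H : X → ℝ) : Set X := bottom H Set.univ

/-- The metastable states: those whose stability level is the maximal stability level of the
states that are not stable (the supremum is a maximum on a finite `X`). -/
def metastableStates {X : Type*} (H : X → ℝ) (Q : X → X → ℝ) : Set X :=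
  {η | stabilityLevel H Q η = ⨆ σ ∈ (stableStates H)ᶜ, stabilityLevel H Q σ}

end Landscape

/-! ### The Potts model on the torus -/

namespace Potts

/-- The set of spin values `{1, …, q}`. -/
abbrev Spin (q : ℕ) : Type := {s : ℕ // s ∈ Finset.Icc 1 q}

/-- The `K × L` grid with periodic boundary conditions. -/
def torus (K L : ℕ) : SimpleGraph (Fin K × Fin L) :=
  SimpleGraph.boxProd (SimpleGraph.cycleGraph K) (SimpleGraph.cycleGraph L)

/-- Spin configurations. -/
abbrev Config (K L q : ℕ) : Type := Fin K × Fin L → Spin q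

open Classical in
/-- The Hamiltonian with negative field `-h`: minus the number of edges whose two endpoints carry
the same spin, plus `h` times the number of vertices with spin `1`. -/
def energy (K L q : ℕ) (h : ℝ) (σ : Config K L q) : ℝ :=
  -(∑ e ∈ (torus K L).edgeFinset, if (e.map σ).IsDiag then (1 : ℝ) else 0)
    + h * ∑ u : Fin K × Fin L, if (σ u : ℕ) = 1 then (1 : ℝ) else 0

/-- The connectivity matrix of single-spin updates. -/
def connectivity (K L q : ℕ) (σ σ' : Config K L q) : ℝ :=
  if (Finset.univ.filter fun v => σ v ≠ σ' v).card = 1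
    then 1 / ((q : ℝ) * (Fintype.card (Fin K × Fin L) : ℝ)) else 0

/-- The configuration with all spins equal to `1`. -/
def allOne (K L q : ℕ) (hq : 2 < q) : Config K L q :=
  fun _ => ⟨1, Finset.mem_Icc.mpr ⟨le_refl 1, by omega⟩⟩

/-- The critical length `ℓ* = ⌈2/h⌉`. -/
def criticalLength (h : ℝ) : ℕ := ⌈2 / h⌉₊

end Potts

end

/-!
Write `ℓ = ℓ*`, `f n = 4 n - h (n (n - 1) + 1)` and `Γ = f ℓ`.

*Leaving `𝟏` costs at least `Γ`.* Call the number of vertices of spin different from `1` the area.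
A row or column meeting both `1` and other spins contains at least two disagreeing edges. If no row
and no column avoids the spin `1`, the area is at most the product of the numbers of mixed rows and
mixed columns; otherwise, the sides of the torus being at least `3 ℓ`, a configuration of area at
most `ℓ ^ 2` has at least `2 ℓ` mixed lines. Hence the energy is at least that of `𝟏` for areas up
to `ℓ (ℓ - 1)`, and exceeds it by at least `Γ` at area `ℓ (ℓ - 1) + 1`. The area changes by at most
one at each step, so every path from `𝟏` to a lower state meets this last value.

*Leaving `𝟏` costs at most `Γ`.* Grow a square droplet of spin `s ≠ 1`, one side at a time; the
barriers met are bounded by values of `f`, which is maximal at `ℓ`.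

*Every other non-stable state has stability level at most `2 < Γ`.* Choose a spin `s ≠ 1` present in
the state. Unless a lower state is reached within the barrier `2`, one reaches within it a state of
the same energy having the largest number of spins `s` among those so reachable. If it is not
constant, it contains a rectangle filled with `s` of maximal size, which does not wrap around the
torus. Each side of it can, within the barrier `2`, be moved outwards (overwriting the adjacent
outer row by `s`) or inwards (overwriting the side by that outer row), and neither move is
favourable. The resulting inequalities for the four sides are incompatible around the corners, so
the state is constant equal to `s`, hence stable.
-/

namespace Landscape

variable {X : Type*} {H : X → ℝ} {Q : X → X → ℝ} {σ η : X} {A : Set X} {C C' b c : ℝ}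

/-- `η` can be reached from `σ` by moves of the connectivity `Q` to states of energy at most `C`;
no bound is imposed on the energy of `σ` itself. -/
def Reachable (H : X → ℝ) (Q : X → X → ℝ) (C : ℝ) : X → X → Prop :=
  Relation.ReflTransGen fun σ η => H η ≤ C ∧ 0 < Q σ η

theorem Reachable.mono (hr : Reachable H Q C σ η) (hC : C ≤ C') : Reachable H Q C' σ η :=
  Relation.ReflTransGen.mono (fun _ _ hστ => ⟨hστ.1.trans hC, hστ.2⟩) _ _ hr

theorem Reachable.exists_path (hr : Reachable H Q C σ η) (hσ : H σ ≤ C) :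
    ∃ ω : Path Q σ η, ∀ i, H (ω.state i) ≤ C := by
  induction hr with
  | refl => exact ⟨⟨0, fun _ => σ, rfl, rfl, fun i => i.elim0⟩, fun _ => hσ⟩
  | @tail τ η _ hτη ih =>
    obtain ⟨ω, hω⟩ := ih
    refine ⟨⟨ω.length + 1, Fin.snoc (α := fun _ => X) ω.state η, ?_, ?_, fun i => ?_⟩, fun i => ?_⟩
    · rw [← Fin.castSucc_zero, Fin.snoc_castSucc, ω.source]
    · rw [Fin.snoc_last]
    · induction i using Fin.lastCases with
      | last =>
        rw [Fin.succ_last, Fin.snoc_last, Fin.snoc_castSucc, ω.target]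
        exact hτη.2
      | cast i =>
        rw [Fin.snoc_castSucc, Fin.succ_castSucc, Fin.snoc_castSucc]
        exact ω.step i
    · induction i using Fin.lastCases with
      | last => simpa using hτη.1
      | cast i => simpa using hω i

theorem Reachable.commHeightSet_le (hr : Reachable H Q C σ η) (hσ : H σ ≤ C) (hη : η ∈ A) :
    commHeightSet H Q {σ} A ≤ C := by
  obtain ⟨ω, hω⟩ := hr.exists_path hσ
  calc commHeightSet H Q {σ} A ≤ ⨅ η ∈ A, commHeight H Q σ η := iInf₂_le σ (Set.mem_singleton σ)
    _ ≤ commHeight H Q σ η := iInf₂_le η hη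
    _ ≤ ω.height H := iInf_le _ ω
    _ ≤ C := EReal.coe_le_coe_iff.2 (Finset.sup'_le _ _ fun i _ => hω i)

theorem le_commHeightSet (hC : ∀ η ∈ A, ∀ ω : Path Q σ η, ∃ i, C ≤ H (ω.state i)) :
    C ≤ commHeightSet H Q {σ} A := by
  refine le_iInf₂ fun σ' hσ' => le_iInf₂ fun η hη => le_iInf fun ω => ?_
  obtain rfl : σ' = σ := hσ'
  obtain ⟨i, hi⟩ := hC η hη ω
  exact EReal.coe_le_coe_iff.2
    (hi.trans (Finset.le_sup' (fun i => H (ω.state i)) (Finset.mem_univ i)))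

theorem barrier_eq (hc : commHeightSet H Q {σ} A = ((H σ + c : ℝ) : EReal)) :
    barrier H Q σ A = c := by
  rw [barrier, hc, ← EReal.coe_sub, add_sub_cancel_left]

theorem Reachable.stabilityLevel_le (hr : Reachable H Q (H σ + c) σ η) (hc : 0 ≤ c)
    (hη : H η < H σ) : stabilityLevel H Q σ ≤ c := by
  refine (EReal.sub_le_sub (hr.commHeightSet_le (by linarith) hη) le_rfl).trans_eq ?_
  rw [← EReal.coe_sub, add_sub_cancel_left]

theorem stabilityLevel_eq_top (hσ : σ ∈ stableStates H) : stabilityLevel H Q σ = ⊤ := by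
  have hempty : lowerStates H σ = ∅ :=
    Set.eq_empty_of_forall_notMem fun η hη => (hσ.2 η trivial).not_gt hη
  simp [stabilityLevel, barrier, commHeightSet, hempty]

theorem stableStates_subset_lowerStates (hσ : σ ∉ stableStates H) :
    stableStates H ⊆ lowerStates H σ := by
  intro η hη
  by_contra hge
  exact hσ ⟨trivial, fun τ hτ => (not_lt.1 hge).trans (hη.2 τ hτ)⟩

theorem stabilityLevel_eq_and_barrier_eq (hσ : σ ∉ stableStates H)
    (hlow : ((H σ + c : ℝ) : EReal) ≤ commHeightSet H Q {σ} (lowerStates H σ))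
    (hup : commHeightSet H Q {σ} (stableStates H) ≤ ((H σ + c : ℝ) : EReal)) :
    stabilityLevel H Q σ = c ∧ barrier H Q σ (stableStates H) = c := by
  have hanti : commHeightSet H Q {σ} (lowerStates H σ)
      ≤ commHeightSet H Q {σ} (stableStates H) :=
    iInf₂_mono fun _ _ => biInf_mono (stableStates_subset_lowerStates hσ)
  exact ⟨barrier_eq (le_antisymm (hanti.trans hup) hlow),
    barrier_eq (le_antisymm hup (hlow.trans hanti))⟩

theorem metastableStates_eq_singleton (hσ : σ ∉ stableStates H)
    (htop : stabilityLevel H Q σ ≠ ⊤)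
    (hlt : ∀ η ∉ stableStates H, η ≠ σ → stabilityLevel H Q η < stabilityLevel H Q σ) :
    metastableStates H Q = {σ} := by
  have hsup : ⨆ η ∈ (stableStates H)ᶜ, stabilityLevel H Q η = stabilityLevel H Q σ := by
    refine le_antisymm (iSup₂_le fun η hη => ?_) (le_iSup₂_of_le σ hσ le_rfl)
    obtain rfl | hne := eq_or_ne η σ
    · exact le_rfl
    · exact (hlt η hη hne).le
  ext η
  rw [metastableStates, Set.mem_ofPred_eq, hsup, Set.mem_singleton_iff]
  refine ⟨fun hη => ?_, fun hη => by rw [hη]⟩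
  by_contra hne
  by_cases hst : η ∈ stableStates H
  · exact htop (hη ▸ stabilityLevel_eq_top hst)
  · exact (hlt η hst hne).ne hη

theorem exists_reachable_stableStates [Finite X]
    (hdescent : ∀ τ ∉ stableStates H, H τ ≤ H σ →
      ∃ η, Reachable H Q (H τ + b) τ η ∧ H η < H τ) :
    ∃ η ∈ stableStates H, Reachable H Q (H σ + b) σ η := by
  obtain ⟨τ, ⟨hr, hle⟩, hmin⟩ := Set.exists_min_image
    {τ | Reachable H Q (H σ + b) σ τ ∧ H τ ≤ H σ} H (Set.toFinite _) ⟨σ, .refl, le_rfl⟩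
  refine ⟨τ, ?_, hr⟩
  by_contra hτ
  obtain ⟨η, hη, hlt⟩ := hdescent τ hτ hle
  exact (hmin η ⟨hr.trans (hη.mono (by gcongr)), hlt.le.trans hle⟩).not_gt hlt

/-- Within the energy barrier `b`, the state `σ` reaches no state of lower energy, and no state of
the same energy with a larger value of `N`. -/
structure IsExtremal (H : X → ℝ) (Q : X → X → ℝ) (b : ℝ) (N : X → ℕ) (σ : X) : Prop where
  energy_le : ∀ {η}, Reachable H Q (H σ + b) σ η → H σ ≤ H η
  le_of_energy_le : ∀ {η}, Reachable H Q (H σ + b) σ η → H η ≤ H σ → N η ≤ N σ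

theorem exists_lower_or_exists_isExtremal [Finite X] (N : X → ℕ) (σ : X) :
    (∃ η, Reachable H Q (H σ + b) σ η ∧ H η < H σ) ∨
      ∃ η, H η = H σ ∧ N σ ≤ N η ∧ IsExtremal H Q b N η := by
  refine or_iff_not_imp_left.2 fun hno => ?_
  push Not at hno
  obtain ⟨τ, ⟨hr, hle⟩, hmax⟩ := Set.exists_max_image
    {τ | Reachable H Q (H σ + b) σ τ ∧ H τ ≤ H σ} N (Set.toFinite _) ⟨σ, .refl, le_rfl⟩
  have heq : H τ = H σ := le_antisymm hle (hno τ hr)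
  refine ⟨τ, heq, hmax σ ⟨.refl, le_rfl⟩, ⟨fun hη => ?_, fun hη hle' => ?_⟩⟩ <;> rw [heq] at *
  · exact hno _ (hr.trans hη)
  · exact hmax _ ⟨hr.trans hη, hle'⟩

end Landscape

namespace Potts

instance {n : ℕ} [hn : Fact (3 ≤ n)] : NeZero n := ⟨by have := hn.out; omega⟩

section Mismatch

variable {α : Type*} {a b c : α} {q : ℕ} {s : Spin q}

open Classical in
/-- The indicator of `a ≠ b`: up to an additive constant, the energy of an edge with spins `a` and
`b` at its endpoints. -/
noncomputable def mismatch (a b : α) : ℝ := if a = b then 0 else 1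

/-- The indicator of the spin `1`, to which the external field couples. -/
noncomputable def oneIndicator (s : Spin q) : ℝ := if (s : ℕ) = 1 then 1 else 0

@[simp]
theorem mismatch_self (a : α) : mismatch a a = 0 := if_pos rfl

theorem mismatch_of_ne (hab : a ≠ b) : mismatch a b = 1 := if_neg hab

theorem mismatch_nonneg : 0 ≤ mismatch a b := by
  unfold mismatch; split_ifs <;> norm_num

theorem mismatch_le_one : mismatch a b ≤ 1 := by
  unfold mismatch; split_ifs <;> norm_num

theorem mismatch_comm (a b : α) : mismatch a b = mismatch b a := by
  unfold mismatch; split_ifs <;> grind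

theorem mismatch_triangle (a b c : α) : mismatch a c ≤ mismatch a b + mismatch b c := by
  unfold mismatch; split_ifs <;> grind

theorem eq_of_mismatch_lt_one (hab : mismatch a b < 1) : a = b := by
  by_contra hne
  exact hab.ne (mismatch_of_ne hne)

theorem oneIndicator_nonneg : 0 ≤ oneIndicator s := by
  unfold oneIndicator; split_ifs <;> norm_num

theorem oneIndicator_of_ne (hs : (s : ℕ) ≠ 1) : oneIndicator s = 0 := if_neg hs

theorem oneIndicator_of_eq (hs : (s : ℕ) = 1) : oneIndicator s = 1 := if_pos hs

end Mismatch

section Torus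

variable {n K L q : ℕ}

theorem val_nsmul_one [NeZero n] (i : ℕ) : (i • (1 : Fin n)).val = i % n := by
  induction i with
  | zero => simp
  | succ i ih => rw [succ_nsmul, Fin.val_add, ih, Fin.val_one', ← Nat.add_mod]

theorem val_nsmul_one_self [NeZero n] (x : Fin n) : x.val • (1 : Fin n) = x :=
  Fin.ext (by rw [val_nsmul_one, Nat.mod_eq_of_lt x.isLt])

theorem addOrderOf_fin_one [NeZero n] : addOrderOf (1 : Fin n) = n :=
  Nat.dvd_right_iff_eq.1 fun m => by
    rw [addOrderOf_dvd_iff_nsmul_eq_zero, Fin.ext_iff, val_nsmul_one, Fin.val_zero,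
      Nat.dvd_iff_mod_eq_zero]

theorem fin_one_ne_zero [hn : Fact (3 ≤ n)] : (1 : Fin n) ≠ 0 := by
  have hord : 1 < addOrderOf (1 : Fin n) := by rw [addOrderOf_fin_one]; linarith [hn.out]
  simpa using nsmul_ne_zero_of_lt_addOrderOf one_ne_zero hord

theorem fin_one_add_one_ne_zero [hn : Fact (3 ≤ n)] : (1 : Fin n) + 1 ≠ 0 := by
  have hord : 2 < addOrderOf (1 : Fin n) := by rw [addOrderOf_fin_one]; exact hn.out
  simpa [two_nsmul] using nsmul_ne_zero_of_lt_addOrderOf two_ne_zero hord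

theorem cycleGraph_adj_iff [Fact (3 ≤ n)] (u v : Fin n) :
    (SimpleGraph.cycleGraph n).Adj u v ↔ v = u + 1 ∨ u = v + 1 := by
  have hne := fin_one_ne_zero (n := n)
  obtain ⟨k, rfl⟩ := Nat.exists_eq_succ_of_ne_zero (NeZero.ne n)
  simp only [SimpleGraph.cycleGraph_eq_circulantGraph, SimpleGraph.circulantGraph,
    SimpleGraph.fromRel_adj, Set.mem_singleton_iff, sub_eq_iff_eq_add']
  grind

/-- The horizontal unit vector. -/
abbrev unitX (K L : ℕ) [NeZero K] [NeZero L] : Fin K × Fin L := (1, 0)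

/-- The vertical unit vector. -/
abbrev unitY (K L : ℕ) [NeZero K] [NeZero L] : Fin K × Fin L := (0, 1)

theorem addOrderOf_unitX [NeZero K] [NeZero L] : addOrderOf (unitX K L) = K := by
  rw [Prod.addOrderOf_mk, addOrderOf_fin_one, addOrderOf_zero, Nat.lcm_one_right]

theorem addOrderOf_unitY [NeZero K] [NeZero L] : addOrderOf (unitY K L) = L := by
  rw [Prod.addOrderOf_mk, addOrderOf_fin_one, addOrderOf_zero, Nat.lcm_one_left]

theorem torus_adj_iff [Fact (3 ≤ K)] [Fact (3 ≤ L)] (u v : Fin K × Fin L) :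
    (torus K L).Adj u v ↔ ∃ d ∈ ({unitX K L, unitY K L} : Finset _), v = u + d ∨ u = v + d := by
  rw [torus, SimpleGraph.boxProd_adj, cycleGraph_adj_iff, cycleGraph_adj_iff]
  simp only [Finset.mem_insert, Finset.mem_singleton, or_and_right, exists_or, exists_eq_left]
  simp only [Prod.ext_iff, Prod.fst_add, Prod.snd_add, add_zero]
  grind

theorem unit_add_unit_ne_zero [Fact (3 ≤ K)] [Fact (3 ≤ L)] :
    ∀ d ∈ ({unitX K L, unitY K L} : Finset _), ∀ d' ∈ ({unitX K L, unitY K L} : Finset _),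
      d + d' ≠ 0 := by
  simp [-Fin.one_eq_zero_iff, fin_one_ne_zero, fin_one_add_one_ne_zero]

theorem sum_edgeFinset_eq {G M : Type*} [AddGroup G] [Fintype G] [AddCommMonoid M]
    {Γ : SimpleGraph G} [Fintype Γ.edgeSet] {D : Finset G}
    (hΓ : ∀ u v, Γ.Adj u v ↔ ∃ d ∈ D, v = u + d ∨ u = v + d)
    (hD : ∀ d ∈ D, ∀ d' ∈ D, d + d' ≠ 0) (g : Sym2 G → M) :
    ∑ e ∈ Γ.edgeFinset, g e = ∑ d ∈ D, ∑ v, g s(v, v + d) := by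
  rw [← Finset.sum_product', eq_comm]
  refine Finset.sum_bij (fun w _ => s(w.2, w.2 + w.1)) ?_ ?_ ?_ fun _ _ => rfl
  · rintro ⟨d, v⟩ hd
    simp only [Finset.mem_product] at hd
    simpa [hΓ] using ⟨d, hd.1, .inl rfl⟩
  · rintro ⟨d, v⟩ hd ⟨d', v'⟩ hd' heq
    simp only [Finset.mem_product] at hd hd'
    rcases Sym2.eq_iff.1 heq with ⟨rfl, h⟩ | ⟨rfl, h⟩
    · exact Prod.ext (add_left_cancel h) rfl
    · rw [add_assoc, add_eq_left] at h
      exact absurd h (hD _ hd'.1 _ hd.1)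
  · intro e he
    induction e with
    | _ u v =>
    rw [SimpleGraph.mem_edgeFinset, SimpleGraph.mem_edgeSet, hΓ] at he
    obtain ⟨d, hd, rfl | rfl⟩ := he
    · exact ⟨(d, u), by simp [hd], rfl⟩
    · exact ⟨(d, v), by simp [hd], Sym2.eq_swap⟩

theorem energy_eq [Fact (3 ≤ K)] [Fact (3 ≤ L)] (h : ℝ) (σ : Config K L q) :
    energy K L q h σ = ∑ v, mismatch (σ v) (σ (v + unitX K L))
      + ∑ v, mismatch (σ v) (σ (v + unitY K L)) + h * ∑ v, oneIndicator (σ v) - 2 * (K * L) := by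
  classical
  have hXY : unitX K L ≠ unitY K L := by simp [-Fin.one_eq_zero_iff, fin_one_ne_zero]
  have hagree (a b : Spin q) : (if a = b then (1 : ℝ) else 0) = 1 - mismatch a b := by
    unfold mismatch; split_ifs <;> norm_num
  rw [energy, sum_edgeFinset_eq torus_adj_iff unit_add_unit_ne_zero, Finset.sum_pair hXY]
  simp only [Sym2.map_mk, Sym2.mk_isDiag_iff, hagree, Finset.sum_sub_distrib, Finset.sum_const,
    Finset.card_univ, Fintype.card_prod, Fintype.card_fin, oneIndicator, nsmul_eq_mul]
  push_cast
  ring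

end Torus

section Update

variable {G α : Type*} [Fintype G] [DecidableEq G] {q : ℕ}

theorem sum_mismatch_update [AddCommGroup G] {e : G} (he : e ≠ 0) (σ : G → α) (v : G) (c : α) :
    ∑ u, mismatch (Function.update σ v c u) (Function.update σ v c (u + e))
      = ∑ u, mismatch (σ u) (σ (u + e)) + (mismatch c (σ (v + e)) - mismatch (σ v) (σ (v + e)))
        + (mismatch c (σ (v - e)) - mismatch (σ v) (σ (v - e))) := by
  rw [add_assoc, ← sub_eq_iff_eq_add', ← Finset.sum_sub_distrib]
  have hsub : v ≠ v - e := by simpa [eq_sub_iff_add_eq] using he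
  have hadd : v + e ≠ v := by simpa using he
  rw [Fintype.sum_eq_add v (v - e) hsub]
  · rw [Function.update_self, Function.update_of_ne hadd, Function.update_of_ne hsub.symm,
      sub_add_cancel, Function.update_self, mismatch_comm c (σ (v - e)),
      mismatch_comm (σ v) (σ (v - e))]
  · rintro u ⟨hu, hu'⟩
    rw [Function.update_of_ne hu, Function.update_of_ne, sub_self]
    exact fun h => hu' (eq_sub_of_add_eq h)

theorem sum_oneIndicator_update (σ : G → Spin q) (v : G) (c : Spin q) :
    ∑ u, oneIndicator (Function.update σ v c u)
      = ∑ u, oneIndicator (σ u) + (oneIndicator c - oneIndicator (σ v)) := by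
  rw [← sub_eq_iff_eq_add', ← Finset.sum_sub_distrib, Fintype.sum_eq_single v]
  · rw [Function.update_self]
  · intro u hu
    rw [Function.update_of_ne hu, sub_self]

end Update

/-- The pairs of perpendicular unit vectors of the torus. -/
def Perp {K L : ℕ} [NeZero K] [NeZero L] (e f : Fin K × Fin L) : Prop :=
  ((e = unitX K L ∨ e = -unitX K L) ∧ (f = unitY K L ∨ f = -unitY K L)) ∨
  ((e = unitY K L ∨ e = -unitY K L) ∧ (f = unitX K L ∨ f = -unitX K L))

section Perp

variable {K L : ℕ} [NeZero K] [NeZero L] {e f : Fin K × Fin L}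

theorem Perp.symm (hef : Perp e f) : Perp f e := by
  unfold Perp at *; tauto

theorem Perp.neg_right (hef : Perp e f) : Perp e (-f) := by
  unfold Perp at *; simp only [neg_eq_iff_eq_neg, neg_neg]; tauto

theorem Perp.neg_left (hef : Perp e f) : Perp (-e) f := hef.symm.neg_right.symm

theorem perp_unitX_unitY : Perp (unitX K L) (unitY K L) := .inl ⟨.inl rfl, .inl rfl⟩

theorem Perp.zsmul_eq_zero (hef : Perp e f) {i j : ℤ} (h : i • e + j • f = 0) : i • e = 0 := by
  rcases hef with ⟨rfl | rfl, rfl | rfl⟩ | ⟨rfl | rfl, rfl | rfl⟩ <;>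
    simp_all [Prod.ext_iff]

theorem Perp.exists_eq_add_zsmul (hef : Perp e f) (o v : Fin K × Fin L) :
    ∃ i j : ℤ, v = o + i • e + j • f := by
  obtain ⟨a, b, hab⟩ : ∃ a b : ℤ, v = o + a • unitX K L + b • unitY K L :=
    ⟨(v - o).1.val, (v - o).2.val, by ext1 <;> simp [val_nsmul_one_self]⟩
  rcases hef with ⟨rfl | rfl, rfl | rfl⟩ | ⟨rfl | rfl, rfl | rfl⟩
  · exact ⟨a, b, hab⟩
  · exact ⟨a, -b, by simpa using hab⟩
  · exact ⟨-a, b, by simpa using hab⟩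
  · exact ⟨-a, -b, by simpa using hab⟩
  · exact ⟨b, a, by rw [hab, add_right_comm]⟩
  · exact ⟨b, -a, by simpa [add_right_comm] using hab⟩
  · exact ⟨-b, a, by simpa [add_right_comm] using hab⟩
  · exact ⟨-b, -a, by simpa [add_right_comm] using hab⟩

end Perp

/-- `Reach h C σ η`: the configuration `η` can be reached from `σ` by single spin flips to
configurations of energy at most `C`. -/
abbrev Reach {K L q : ℕ} (h C : ℝ) : Config K L q → Config K L q → Prop :=
  Landscape.Reachable (energy K L q h) (connectivity K L q) C

section EnergyUpdate

variable {K L q : ℕ} [hK : Fact (3 ≤ K)] [hL : Fact (3 ≤ L)] {e f : Fin K × Fin L}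

theorem Perp.three_le_addOrderOf (hef : Perp e f) : 3 ≤ addOrderOf e := by
  rcases hef with ⟨rfl | rfl, -⟩ | ⟨rfl | rfl, -⟩ <;>
    simpa only [addOrderOf_neg, addOrderOf_unitX, addOrderOf_unitY] using Fact.out

theorem Perp.ne_zero (hef : Perp e f) : e ≠ 0 := by
  rintro rfl
  simpa using hef.three_le_addOrderOf

theorem energy_update (h : ℝ) (hef : Perp e f) (σ : Config K L q) (v : Fin K × Fin L)
    (c : Spin q) :
    energy K L q h (Function.update σ v c) = energy K L q h σ
      + (mismatch c (σ (v + e)) - mismatch (σ v) (σ (v + e)))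
      + (mismatch c (σ (v - e)) - mismatch (σ v) (σ (v - e)))
      + (mismatch c (σ (v + f)) - mismatch (σ v) (σ (v + f)))
      + (mismatch c (σ (v - f)) - mismatch (σ v) (σ (v - f)))
      + h * (oneIndicator c - oneIndicator (σ v)) := by
  have hXY := perp_unitX_unitY (K := K) (L := L)
  rw [energy_eq, energy_eq, sum_oneIndicator_update, sum_mismatch_update hXY.ne_zero,
    sum_mismatch_update hXY.symm.ne_zero]
  have hadd (w : Fin K × Fin L) : v + -w = v - w := (sub_eq_add_neg v w).symm
  have hsub (w : Fin K × Fin L) : v - -w = v + w := sub_neg_eq_add v w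
  rcases hef with ⟨rfl | rfl, rfl | rfl⟩ | ⟨rfl | rfl, rfl | rfl⟩ <;>
    (try simp only [hadd, hsub]) <;> ring

theorem connectivity_update_pos {σ : Config K L q} {v : Fin K × Fin L} {c : Spin q}
    (hc : σ v ≠ c) : 0 < connectivity K L q σ (Function.update σ v c) := by
  have hq : 0 < q := by have := Finset.mem_Icc.1 c.2; omega
  have hdiff : (Finset.univ.filter fun u => σ u ≠ Function.update σ v c u) = {v} := by
    ext u
    obtain rfl | huv := eq_or_ne u v <;> simp [*]
  rw [connectivity, if_pos (by rw [hdiff, Finset.card_singleton])]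
  exact one_div_pos.2 (mul_pos (Nat.cast_pos.2 hq) (Nat.cast_pos.2 Fintype.card_pos))

theorem reach_update {h C : ℝ} {σ : Config K L q} {v : Fin K × Fin L} {c : Spin q}
    (hC : energy K L q h (Function.update σ v c) ≤ C) : Reach h C σ (Function.update σ v c) := by
  obtain heq | hne := eq_or_ne (σ v) c
  · rw [← heq, Function.update_eq_self]
    exact .refl
  · exact .single ⟨hC, connectivity_update_pos hne⟩

end EnergyUpdate

section Row

variable {q : ℕ} {h : ℝ} {s : Spin q} {b : ℕ → Spin q} {m : ℕ}

/-- The energy of a row of spins `b 0, …, b m`: the mismatches inside the row and the field. -/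
noncomputable def rowEnergy (h : ℝ) (b : ℕ → Spin q) (m : ℕ) : ℝ :=
  ∑ i ∈ Finset.range m, mismatch (b i) (b (i + 1))
    + h * ∑ i ∈ Finset.range (m + 1), oneIndicator (b i)

theorem rowEnergy_zero (h : ℝ) (b : ℕ → Spin q) : rowEnergy h b 0 = h * oneIndicator (b 0) := by
  simp [rowEnergy]

theorem rowEnergy_succ (h : ℝ) (b : ℕ → Spin q) (m : ℕ) :
    rowEnergy h b (m + 1)
      = rowEnergy h b m + mismatch (b m) (b (m + 1)) + h * oneIndicator (b (m + 1)) := by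
  rw [rowEnergy, rowEnergy, Finset.sum_range_succ, Finset.sum_range_succ _ (m + 1)]
  ring

theorem rowEnergy_mono (h0 : 0 ≤ h) (b : ℕ → Spin q) : Monotone (rowEnergy h b) :=
  monotone_nat_of_le_succ fun m => by
    rw [rowEnergy_succ, add_assoc]
    exact le_add_of_nonneg_right
      (add_nonneg mismatch_nonneg (mul_nonneg h0 oneIndicator_nonneg))

theorem rowEnergy_nonneg (h0 : 0 ≤ h) : 0 ≤ rowEnergy h b m := by
  refine le_trans ?_ (rowEnergy_mono h0 b m.zero_le)
  rw [rowEnergy_zero]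
  exact mul_nonneg h0 oneIndicator_nonneg

theorem eq_of_rowEnergy_lt_one (h0 : 0 ≤ h) (hb : rowEnergy h b m < 1) {i : ℕ} (hi : i ≤ m) :
    b i = b 0 := by
  induction i with
  | zero => rfl
  | succ i ih =>
    rw [← ih (by omega)]
    refine (eq_of_mismatch_lt_one ?_).symm
    have hle := (rowEnergy_mono h0 b hi).trans_lt hb
    rw [rowEnergy_succ] at hle
    have := rowEnergy_nonneg (b := b) (m := i) h0
    have := mul_nonneg h0 (oneIndicator_nonneg (s := b (i + 1)))
    linarith

theorem rowEnergy_const (h : ℝ) (hb : ∀ i ≤ m, b i = s) :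
    rowEnergy h b m = h * ((m + 1) * oneIndicator s) := by
  induction m with
  | zero => simp [rowEnergy_zero, hb 0 le_rfl]
  | succ m ih =>
    rw [rowEnergy_succ, ih fun i hi => hb i (by omega), hb m m.le_succ, hb (m + 1) le_rfl,
      mismatch_self]
    push_cast
    ring

end Row

section Sweep

variable {G α : Type*} [AddCommGroup G] {σ : G → α} {x e p v : G} {j k : ℕ}

open Classical in
/-- The configuration in which the vertices `x, x + e, …, x + (k - 1) e` have received the spins of
their `p`-neighbours. -/
noncomputable def sweep (σ : G → α) (x e p : G) (k : ℕ) (v : G) : α :=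
  if ∃ j < k, v = x + j • e then σ (v + p) else σ v

@[simp]
theorem sweep_zero : sweep σ x e p 0 = σ := by
  ext v; simp [sweep]

theorem sweep_succ [DecidableEq G] : sweep σ x e p (k + 1)
    = Function.update (sweep σ x e p k) (x + k • e) (σ (x + k • e + p)) := by
  ext v
  obtain rfl | hv := eq_or_ne v (x + k • e)
  · rw [Function.update_self, sweep, if_pos ⟨k, k.lt_succ_self, rfl⟩]
  · rw [Function.update_of_ne hv, sweep, sweep]
    congr 1
    simp only [Nat.exists_lt_succ_right, hv, or_false]

theorem sweep_of_ne (hv : ∀ j < k, v ≠ x + j • e) : sweep σ x e p k v = σ v :=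
  if_neg fun ⟨j, hj, h⟩ => hv j hj h

theorem sweep_apply (hjk : j < k) : sweep σ x e p k (x + j • e) = σ (x + j • e + p) :=
  if_pos ⟨j, hjk, rfl⟩

theorem sweep_ahead (hj : k ≤ j) (hj' : j < addOrderOf e) :
    sweep σ x e p k (x + j • e) = σ (x + j • e) :=
  sweep_of_ne fun i hi h =>
    (hi.trans_le hj).ne' (nsmul_injOn_Iio_addOrderOf hj' (by simp; omega) (add_left_cancel h))

theorem sweep_eq_of_side {s : α} (hside : ∀ i < k, σ (x + i • e + p) = s) (hv : σ v = s) :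
    sweep σ x e p k v = s := by
  unfold sweep
  split_ifs with hvx
  · obtain ⟨j, hj, rfl⟩ := hvx
    exact hside j hj
  · exact hv

end Sweep

section EnergySweep

variable {K L q : ℕ} [Fact (3 ≤ K)] [Fact (3 ≤ L)] {h : ℝ} {σ : Config K L q}
  {x e p : Fin K × Fin L} {s : Spin q} {k m : ℕ}

theorem Perp.add_nsmul_add_ne (hep : Perp e p) (x : Fin K × Fin L) (i j : ℕ) :
    x + i • e + p ≠ x + j • e := by
  intro h
  refine hep.symm.ne_zero ?_
  have hz : (1 : ℤ) • p + ((i : ℤ) - j) • e = 0 := by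
    rw [add_assoc, add_left_cancel_iff, ← sub_eq_zero] at h
    rw [← h, one_zsmul, sub_zsmul, natCast_zsmul, natCast_zsmul]
    abel
  simpa using hep.symm.zsmul_eq_zero hz

theorem energy_sweep_succ (h : ℝ) (hep : Perp e p) (hk : k < addOrderOf e) :
    energy K L q h (sweep σ x e p (k + 1)) = energy K L q h (sweep σ x e p k)
      + (mismatch (σ (x + k • e + p)) (sweep σ x e p k (x + k • e + e))
          - mismatch (σ (x + k • e)) (sweep σ x e p k (x + k • e + e)))
      + (mismatch (σ (x + k • e + p)) (sweep σ x e p k (x + k • e - e))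
          - mismatch (σ (x + k • e)) (sweep σ x e p k (x + k • e - e)))
      - mismatch (σ (x + k • e)) (σ (x + k • e + p))
      + (mismatch (σ (x + k • e + p)) (σ (x + k • e - p))
          - mismatch (σ (x + k • e)) (σ (x + k • e - p)))
      + h * (oneIndicator (σ (x + k • e + p)) - oneIndicator (σ (x + k • e))) := by
  have hfront : sweep σ x e p k (x + k • e + p) = σ (x + k • e + p) :=
    sweep_of_ne fun j _ => hep.add_nsmul_add_ne x k j
  have hback : sweep σ x e p k (x + k • e - p) = σ (x + k • e - p) :=
    sweep_of_ne fun j _ => by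
      simpa only [sub_eq_add_neg] using hep.neg_right.add_nsmul_add_ne x k j
  rw [sweep_succ, energy_update h hep, sweep_ahead le_rfl hk, hfront, hback, mismatch_self]
  ring

theorem reach_sweep {C : ℝ} (hC : ∀ k < m, energy K L q h (sweep σ x e p (k + 1)) ≤ C) :
    Reach h C σ (sweep σ x e p m) := by
  induction m with
  | zero => rw [sweep_zero]; exact .refl
  | succ m ih =>
    have hlast := hC m m.lt_succ_self
    rw [sweep_succ] at hlast ⊢
    exact (ih fun k hk => hC k (by omega)).trans (reach_update hlast)

theorem energy_sweep_expand_succ_le (hep : Perp e p) (hs : (s : ℕ) ≠ 1)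
    (hk : k + 1 < addOrderOf e) (hside : σ (x + k • e + p) = s) (hne : σ (x + k • e) ≠ s) :
    energy K L q h (sweep σ x e p (k + 1)) ≤ energy K L q h (sweep σ x e p k)
      + mismatch s (sweep σ x e p k (x + k • e - e))
      - mismatch (σ (x + k • e)) (sweep σ x e p k (x + k • e - e))
      + 1 - mismatch (σ (x + k • e)) (σ (x + (k + 1) • e))
      - h * oneIndicator (σ (x + k • e)) := by
  have hnext : sweep σ x e p k (x + k • e + e) = σ (x + (k + 1) • e) := by
    rw [add_assoc, ← succ_nsmul, sweep_ahead k.le_succ hk]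
  have hnext_le := mismatch_le_one (a := s) (b := σ (x + (k + 1) • e))
  have hback_le := mismatch_triangle s (σ (x + k • e)) (σ (x + k • e - p))
  rw [mismatch_of_ne hne.symm] at hback_le
  rw [energy_sweep_succ h hep (k.lt_succ_self.trans hk), hside, hnext, mismatch_of_ne hne,
    oneIndicator_of_ne hs]
  linarith

theorem energy_sweep_expand_le (hep : Perp e p) (hs : (s : ℕ) ≠ 1)
    (hm : m + 1 < addOrderOf e) (hside : ∀ i ≤ m, σ (x + i • e + p) = s)
    (hne : ∀ i ≤ m, σ (x + i • e) ≠ s) :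
    energy K L q h (sweep σ x e p (m + 1)) ≤ energy K L q h σ + 2 - mismatch (σ (x - e)) (σ x)
      - rowEnergy h (fun i => σ (x + i • e)) m
      - mismatch (σ (x + m • e)) (σ (x + (m + 1) • e)) := by
  induction m with
  | zero =>
    have hflip := energy_sweep_expand_succ_le (h := h) hep hs hm (hside 0 le_rfl) (hne 0 le_rfl)
    have hprev_le := mismatch_le_one (a := s) (b := σ (x - e))
    have hcomm := mismatch_comm (σ x) (σ (x - e))
    simp only [sweep_zero, zero_nsmul, add_zero, rowEnergy_zero] at hflip ⊢
    linarith
  | succ m ih =>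
    have hprev : sweep σ x e p (m + 1) (x + (m + 1) • e - e) = s := by
      rw [succ_nsmul, ← add_assoc, add_sub_cancel_right, sweep_apply m.lt_succ_self,
        hside m m.le_succ]
    have hflip := energy_sweep_expand_succ_le (h := h) hep hs hm (hside _ le_rfl) (hne _ le_rfl)
    rw [hprev, mismatch_self, mismatch_of_ne (hne (m + 1) le_rfl)] at hflip
    rw [rowEnergy_succ]
    linarith [ih (by omega) (fun i hi => hside i (by omega)) (fun i hi => hne i (by omega))]

theorem reach_sweep_expand (h0 : 0 ≤ h) (hep : Perp e p) (hs : (s : ℕ) ≠ 1)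
    (hm : m < addOrderOf e) (hside : ∀ i < m, σ (x + i • e + p) = s)
    (hne : ∀ i < m, σ (x + i • e) ≠ s) :
    Reach h (energy K L q h σ + 2) σ (sweep σ x e p m) := by
  refine reach_sweep fun k hk => (energy_sweep_expand_le hep hs (by omega)
    (fun i hi => hside i (by omega)) (fun i hi => hne i (by omega))).trans ?_
  have := mismatch_nonneg (a := σ (x - e)) (b := σ x)
  have := mismatch_nonneg (a := σ (x + k • e)) (b := σ (x + (k + 1) • e))
  have := rowEnergy_nonneg (b := fun i => σ (x + i • e)) (m := k) h0
  linarith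

theorem energy_sweep_line_le (h0 : 0 ≤ h) (hep : Perp e p) (hs : (s : ℕ) ≠ 1)
    (hside : ∀ i : ℕ, σ (x + i • e + p) = s) (hne : ∀ i : ℕ, σ (x + i • e) ≠ s) :
    energy K L q h (sweep σ x e p (addOrderOf e)) ≤ energy K L q h σ := by
  obtain ⟨m, hm⟩ : ∃ m, addOrderOf e = m + 1 + 1 :=
    ⟨addOrderOf e - 2, by have := hep.three_le_addOrderOf; omega⟩
  have hopen := energy_sweep_expand_le (h := h) hep hs (m := m) (x := x) (by omega)
    (fun i _ => hside i) fun i _ => hne i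
  have hclose := energy_sweep_succ (σ := σ) (x := x) (k := m + 1) h hep (by omega)
  have hnext : sweep σ x e p (m + 1) (x + (m + 1) • e + e) = s := by
    rw [add_assoc, ← succ_nsmul, ← hm, addOrderOf_nsmul_eq_zero, ← zero_nsmul e,
      sweep_apply m.succ_pos, hside]
  have hprev : sweep σ x e p (m + 1) (x + (m + 1) • e - e) = s := by
    rw [succ_nsmul, ← add_assoc, add_sub_cancel_right, sweep_apply m.lt_succ_self, hside]
  have hback_le := mismatch_triangle s (σ (x + (m + 1) • e)) (σ (x + (m + 1) • e - p))
  rw [mismatch_of_ne (hne (m + 1)).symm] at hback_le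
  rw [hside, hnext, hprev, mismatch_self, mismatch_of_ne (hne (m + 1)), oneIndicator_of_ne hs]
    at hclose
  have := mismatch_nonneg (a := σ (x - e)) (b := σ x)
  have := mismatch_nonneg (a := σ (x + m • e)) (b := σ (x + (m + 1) • e))
  have := rowEnergy_nonneg (b := fun i => σ (x + i • e)) (m := m) h0
  have := mul_nonneg h0 (oneIndicator_nonneg (s := σ (x + (m + 1) • e)))
  rw [hm]
  linarith

theorem energy_sweep_consume_succ_le (hep : Perp e p) (hs : (s : ℕ) ≠ 1)
    (hk : k + 1 < addOrderOf e) (hrow : σ (x + k • e) = s) (hside : σ (x + k • e + p) ≠ s) :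
    energy K L q h (sweep σ x e p (k + 1)) ≤ energy K L q h (sweep σ x e p k)
      + mismatch (σ (x + k • e + p)) (sweep σ x e p k (x + k • e - e))
      - mismatch s (sweep σ x e p k (x + k • e - e))
      + mismatch (σ (x + k • e + p)) (σ (x + (k + 1) • e)) - mismatch s (σ (x + (k + 1) • e))
      - mismatch s (σ (x + k • e - p)) + h * oneIndicator (σ (x + k • e + p)) := by
  have hnext : sweep σ x e p k (x + k • e + e) = σ (x + (k + 1) • e) := by
    rw [add_assoc, ← succ_nsmul, sweep_ahead k.le_succ hk]
  have hback_le := mismatch_le_one (a := σ (x + k • e + p)) (b := σ (x + k • e - p))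
  rw [energy_sweep_succ h hep (k.lt_succ_self.trans hk), hrow, hnext, mismatch_of_ne hside.symm,
    oneIndicator_of_ne hs]
  linarith

theorem energy_sweep_consume_le (hep : Perp e p) (hs : (s : ℕ) ≠ 1)
    (hm : m + 1 < addOrderOf e) (hrow : ∀ i ≤ m, σ (x + i • e) = s)
    (hside : ∀ i ≤ m, σ (x + i • e + p) ≠ s) (hprev : σ (x - e) ≠ s) :
    energy K L q h (sweep σ x e p (m + 1)) ≤ energy K L q h σ
      + mismatch (σ (x - e)) (σ (x + p)) + rowEnergy h (fun i => σ (x + i • e + p)) m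
      + mismatch (σ (x + m • e + p)) (σ (x + (m + 1) • e)) - mismatch s (σ (x + (m + 1) • e))
      - mismatch s (σ (x - p)) - 1 := by
  induction m with
  | zero =>
    have hflip := energy_sweep_consume_succ_le (h := h) hep hs hm (hrow 0 le_rfl) (hside 0 le_rfl)
    simp only [sweep_zero, zero_nsmul, add_zero, rowEnergy_zero, mismatch_of_ne hprev.symm,
      mismatch_comm _ (σ (x - e))] at hflip ⊢
    linarith
  | succ m ih =>
    have hprev' : sweep σ x e p (m + 1) (x + (m + 1) • e - e) = σ (x + m • e + p) := by
      rw [succ_nsmul, ← add_assoc, add_sub_cancel_right, sweep_apply m.lt_succ_self]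
    have hflip := energy_sweep_consume_succ_le (h := h) hep hs hm (hrow _ le_rfl) (hside _ le_rfl)
    rw [hprev', mismatch_comm _ (σ (x + m • e + p)), mismatch_of_ne (hside m m.le_succ).symm]
      at hflip
    have ih' := ih (by omega) (fun i hi => hrow i (by omega)) fun i hi => hside i (by omega)
    rw [hrow (m + 1) le_rfl, mismatch_of_ne (hside m m.le_succ), mismatch_self] at ih'
    have := mismatch_nonneg (a := s) (b := σ (x + (m + 1) • e - p))
    rw [rowEnergy_succ]
    linarith

theorem reach_sweep_consume (h0 : 0 ≤ h) (hep : Perp e p) (hs : (s : ℕ) ≠ 1)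
    (hm : m + 1 < addOrderOf e) (hrow : ∀ i ≤ m, σ (x + i • e) = s)
    (hside : ∀ i ≤ m, σ (x + i • e + p) ≠ s) (hprev : σ (x - e) ≠ s)
    (hle : mismatch (σ (x - e)) (σ (x + p)) + rowEnergy h (fun i => σ (x + i • e + p)) m ≤ 2) :
    Reach h (energy K L q h σ + 2) σ (sweep σ x e p (m + 1)) := by
  refine reach_sweep fun k hk => (energy_sweep_consume_le hep hs (by omega)
    (fun i hi => hrow i (by omega)) (fun i hi => hside i (by omega)) hprev).trans ?_
  have hmono := rowEnergy_mono h0 (fun i => σ (x + i • e + p)) (Nat.lt_succ_iff.1 hk)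
  have := mismatch_nonneg (a := s) (b := σ (x - p))
  have := mismatch_nonneg (a := s) (b := σ (x + (k + 1) • e))
  have := mismatch_le_one (a := σ (x + k • e + p)) (b := σ (x + (k + 1) • e))
  linarith

end EnergySweep


section Extremal

variable {K L q : ℕ} {h : ℝ} {s : Spin q} {σ τ : Config K L q} {e f p x : Fin K × Fin L} {m : ℕ}

/-- The number of vertices of spin `s`. -/
def spinCount (s : Spin q) (σ : Config K L q) : ℕ :=
  (Finset.univ.filter fun v => σ v = s).card

/-- Within the energy barrier `2`, the configuration `σ` reaches no configuration of lower energy,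
and none of the same energy with more vertices of spin `s`. -/
abbrev Extremal (h : ℝ) (s : Spin q) (σ : Config K L q) : Prop :=
  Landscape.IsExtremal (energy K L q h) (connectivity K L q) 2 (spinCount s) σ

theorem Extremal.lt_energy_of_grow (hσ : Extremal h s σ)
    (hr : Reach h (energy K L q h σ + 2) σ τ) (hsub : ∀ v, σ v = s → τ v = s)
    {w : Fin K × Fin L} (hw : σ w ≠ s) (hw' : τ w = s) :
    energy K L q h σ < energy K L q h τ := by
  by_contra! hle
  refine (hσ.le_of_energy_le hr hle).not_gt (Finset.card_lt_card ?_)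
  refine Finset.ssubset_iff_of_subset (fun v => ?_) |>.2 ⟨w, ?_, ?_⟩ <;>
    simp_all

variable [Fact (3 ≤ K)] [Fact (3 ≤ L)]

theorem Extremal.ne_of_perp (h0 : 0 ≤ h) (hs : (s : ℕ) ≠ 1) (hσ : Extremal h s σ)
    (hef : Perp e f) (hx : σ x ≠ s) (he : σ (x + e) = s) : σ (x + f) ≠ s := by
  intro hf
  have hflip := energy_update h hef σ x s
  rw [he, hf, mismatch_self, mismatch_of_ne hx, oneIndicator_of_ne hs] at hflip
  have he' := mismatch_triangle s (σ x) (σ (x - e))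
  have hf' := mismatch_triangle s (σ x) (σ (x - f))
  rw [mismatch_of_ne hx.symm] at he' hf'
  have hle : energy K L q h (Function.update σ x s) ≤ energy K L q h σ := by
    linarith [mul_nonneg h0 (oneIndicator_nonneg (s := σ x))]
  refine hle.not_gt (hσ.lt_energy_of_grow (reach_update (by linarith)) (fun v hv => ?_) hx
    (Function.update_self ..))
  rwa [Function.update_of_ne (by rintro rfl; exact hx hv)]

theorem Extremal.eq_iff_eq_of_side (h0 : 0 ≤ h) (hs : (s : ℕ) ≠ 1) (hσ : Extremal h s σ)
    (hep : Perp e p) (hx : σ (x + p) = s) (hxe : σ (x + e + p) = s) :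
    σ (x + e) = s ↔ σ x = s := by
  refine ⟨fun hs' => ?_, fun hs' => ?_⟩ <;> by_contra hne
  · exact hσ.ne_of_perp h0 hs hep hne hs' hx
  · exact hσ.ne_of_perp h0 hs hep.neg_left hne (by rwa [add_neg_cancel_right]) hxe

theorem Extremal.eq_or_ne_of_side (h0 : 0 ≤ h) (hs : (s : ℕ) ≠ 1) (hσ : Extremal h s σ)
    (hep : Perp e p) (hside : ∀ i ≤ m, σ (x + i • e + p) = s) :
    (∀ i ≤ m, σ (x + i • e) = s) ∨ ∀ i ≤ m, σ (x + i • e) ≠ s := by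
  have hiff : ∀ i ≤ m, σ (x + i • e) = s ↔ σ x = s := by
    intro i hi
    induction i with
    | zero => rw [zero_nsmul, add_zero]
    | succ i ih =>
      have hi' := hside (i + 1) hi
      rw [succ_nsmul, ← add_assoc] at hi' ⊢
      exact (hσ.eq_iff_eq_of_side h0 hs hep (hside i (by omega)) hi').trans (ih (by omega))
  exact (em (σ x = s)).imp (fun hx i hi => (hiff i hi).2 hx) fun hx i hi => mt (hiff i hi).1 hx

theorem Extremal.line_eq (h0 : 0 ≤ h) (hs : (s : ℕ) ≠ 1) (hσ : Extremal h s σ)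
    (hep : Perp e p) (hside : ∀ i : ℕ, σ (x + i • e + p) = s) (i : ℕ) : σ (x + i • e) = s := by
  by_contra hi
  have hne (j : ℕ) : σ (x + j • e) ≠ s :=
    ((hσ.eq_or_ne_of_side (m := max i j) h0 hs hep fun k _ => hside k).resolve_left
      fun heq => hi (heq i (le_max_left ..))) j (le_max_right ..)
  obtain ⟨m, hm⟩ : ∃ m, addOrderOf e = m + 1 :=
    ⟨addOrderOf e - 1, by have := hep.three_le_addOrderOf; omega⟩
  have hle := energy_sweep_line_le h0 hep hs hside hne
  have hreach : Reach h (energy K L q h σ + 2) σ (sweep σ x e p (m + 1)) := by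
    refine (reach_sweep_expand h0 hep hs (m := m) (by omega) (fun i _ => hside i)
      fun i _ => hne i).trans ?_
    rw [hm] at hle
    rw [sweep_succ] at hle ⊢
    exact reach_update (by linarith)
  rw [hm] at hle
  refine hle.not_gt (hσ.lt_energy_of_grow hreach (w := x + m • e)
    (fun v => sweep_eq_of_side fun i _ => hside i) (hne m) ?_)
  rw [sweep_apply m.lt_succ_self, hside]

theorem Extremal.eq_const_of_line (h0 : 0 ≤ h) (hs : (s : ℕ) ≠ 1) (hσ : Extremal h s σ)
    (hef : Perp e f) (hrow : ∀ i : ℕ, σ (x + i • e) = s) (v : Fin K × Fin L) : σ v = s := by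
  have hrows (j : ℕ) : ∀ i : ℕ, σ (x + j • f + i • e) = s := by
    induction j with
    | zero => simpa using hrow
    | succ j ih =>
      refine hσ.line_eq h0 hs hef.neg_right fun i => ?_
      rw [← ih i, succ_nsmul]
      congr 1
      abel
  obtain ⟨i, j, rfl⟩ := hef.exists_eq_add_zsmul x v
  obtain ⟨i', hi'⟩ := mem_multiples_iff_mem_zmultiples.2 ⟨i, (rfl : _ = i • e)⟩
  obtain ⟨j', hj'⟩ := mem_multiples_iff_mem_zmultiples.2 ⟨j, (rfl : _ = j • f)⟩
  rw [← hrows j' i', add_right_comm]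
  exact congrArg σ (by simp only [← hi', ← hj'])

end Extremal

/-- The rectangle of the points `origin + i • e + j • f` with `0 ≤ i ≤ m` and `0 ≤ j ≤ n`. -/
structure Rectangle (G : Type*) where
  origin : G
  e : G
  f : G
  m : ℕ
  n : ℕ

namespace Rectangle

section Site

variable {G : Type*} [AddCommGroup G] (R : Rectangle G)

/-- The point with coordinates `i` and `j` in the frame of the rectangle. -/
def site (i j : ℤ) : G := R.origin + i • R.e + j • R.f

/-- The same rectangle, turned by a right angle: its right side becomes the base. -/
@[simps]
def rotate : Rectangle G := ⟨R.origin + R.m • R.e, R.f, -R.e, R.n, R.m⟩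

@[simp]
theorem site_rotate (i j : ℤ) : R.rotate.site i j = R.site (R.m - j) i := by
  simp only [site, rotate, smul_neg, sub_smul, natCast_zsmul]
  abel

@[simp]
theorem site_sub_e (i j : ℤ) : R.site i j - R.e = R.site (i - 1) j := by
  simp only [site, sub_smul, one_smul]
  abel

@[simp]
theorem site_add_f (i j : ℤ) : R.site i j + R.f = R.site i (j + 1) := by
  simp only [site, add_smul, one_smul, add_assoc]

@[simp]
theorem site_add_neg_f (i j : ℤ) : R.site i j + -R.f = R.site i (j - 1) := by
  simp only [site, sub_smul, one_smul]
  abel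

@[simp]
theorem site_add_nsmul_e (i j : ℤ) (k : ℕ) : R.site i j + k • R.e = R.site (i + k) j := by
  simp only [site, add_smul, natCast_zsmul]
  abel

end Site

variable {K L q : ℕ} {h : ℝ} {s b : Spin q} {σ : Config K L q} {R : Rectangle (Fin K × Fin L)}
  [Fact (3 ≤ K)] [Fact (3 ≤ L)]

/-- The spins below the base of the rectangle. -/
def base (R : Rectangle (Fin K × Fin L)) (σ : Config K L q) (i : ℕ) : Spin q := σ (R.site i (-1))

/-- The spin diagonally below the origin of the rectangle. -/
def corner (R : Rectangle (Fin K × Fin L)) (σ : Config K L q) : Spin q := σ (R.site (-1) (-1))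

/-- All vertices of the rectangle have spin `s`. -/
structure IsFilled (R : Rectangle (Fin K × Fin L)) (σ : Config K L q) (s : Spin q) : Prop where
  perp : Perp R.e R.f
  eq : ∀ i ∈ Set.Icc (0 : ℤ) R.m, ∀ j ∈ Set.Icc (0 : ℤ) R.n, σ (R.site i j) = s

/-- All vertices of the rectangle have spin `s`, and none of the vertices along its four sides
does. -/
structure IsIsolated (R : Rectangle (Fin K × Fin L)) (σ : Config K L q) (s : Spin q) : Prop
    extends IsFilled R σ s where
  width : R.m + 1 < addOrderOf R.e
  height : R.n + 1 < addOrderOf R.f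
  bottom : ∀ i ∈ Set.Icc (0 : ℤ) R.m, σ (R.site i (-1)) ≠ s
  top : ∀ i ∈ Set.Icc (0 : ℤ) R.m, σ (R.site i (R.n + 1)) ≠ s
  left : ∀ j ∈ Set.Icc (0 : ℤ) R.n, σ (R.site (-1) j) ≠ s
  right : ∀ j ∈ Set.Icc (0 : ℤ) R.n, σ (R.site (R.m + 1) j) ≠ s

theorem IsFilled.rotate (hR : R.IsFilled σ s) : R.rotate.IsFilled σ s where
  perp := hR.perp.symm.neg_right
  eq i hi j hj := by
    rw [site_rotate]
    exact hR.eq _ (by simp_all) _ hi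

theorem IsIsolated.rotate (hR : R.IsIsolated σ s) : R.rotate.IsIsolated σ s where
  toIsFilled := hR.toIsFilled.rotate
  width := hR.height
  height := by simpa using hR.width
  bottom i hi := by simpa using hR.right i hi
  top i hi := by simpa using hR.left i hi
  left j hj := by simpa using hR.bottom (R.m - j) (by simp_all)
  right j hj := by simpa using hR.top (R.m - j) (by simp_all)

theorem corner_rotate : R.rotate.corner σ = σ (R.site (R.m + 1) (-1)) := by
  simp [corner]

theorem base_rotate_zero : R.rotate.base σ 0 = σ (R.site (R.m + 1) 0) := by
  simp [base]

theorem IsIsolated.rowEnergy_base_lt (h0 : 0 ≤ h) (hs : (s : ℕ) ≠ 1) (hσ : Extremal h s σ)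
    (hR : R.IsIsolated σ s) :
    mismatch (R.corner σ) (R.base σ 0) + rowEnergy h (R.base σ) R.m
      + mismatch (R.base σ R.m) (R.rotate.corner σ) < 2 := by
  have hside : ∀ i ≤ R.m, σ (R.site 0 (-1) + i • R.e + R.f) = s := fun i hi => by
    simpa using hR.eq i (by simpa using hi) 0 (by simp)
  have hne : ∀ i ≤ R.m, σ (R.site 0 (-1) + i • R.e) ≠ s := fun i hi => by
    simpa using hR.bottom i (by simpa using hi)
  have hle := energy_sweep_expand_le (h := h) hR.perp hs hR.width hside hne
  have hlt := hσ.lt_energy_of_grow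
    (reach_sweep_expand h0 hR.perp hs hR.width (fun i hi => hside i (by omega))
      fun i hi => hne i (by omega))
    (fun v => sweep_eq_of_side fun i hi => hside i (by omega)) (hne 0 (by omega))
    (by rw [sweep_apply R.m.succ_pos, hside 0 (by omega)])
  simp only [site_add_nsmul_e, site_sub_e, zero_add, zero_sub, Nat.cast_add, Nat.cast_one] at hle
  rw [corner_rotate]
  unfold base corner
  rw [Nat.cast_zero]
  linarith

/-- The configuration in which the spins below the base have replaced the lowest row of the
rectangle. -/
noncomputable def consume (R : Rectangle (Fin K × Fin L)) (σ : Config K L q) : Config K L q :=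
  sweep σ (R.site 0 0) R.e (-R.f) (R.m + 1)

theorem IsIsolated.energy_consume_le (hs : (s : ℕ) ≠ 1) (hR : R.IsIsolated σ s) :
    energy K L q h (R.consume σ) ≤ energy K L q h σ + mismatch (σ (R.site (-1) 0)) (R.base σ 0)
      + rowEnergy h (R.base σ) R.m + mismatch (R.base σ R.m) (R.rotate.base σ 0)
      - mismatch s (σ (R.site 0 1)) - 2 := by
  have hle := energy_sweep_consume_le (h := h) (σ := σ) (x := R.site 0 0) hR.perp.neg_right hs
    hR.width
    (fun i hi => by simpa using hR.eq i (by simpa using hi) 0 (by simp))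
    (fun i hi => by simpa using hR.bottom i (by simpa using hi))
    (by simpa using hR.left 0 (by simp))
  simp only [site_add_nsmul_e, site_sub_e, site_add_neg_f, sub_neg_eq_add, site_add_f, zero_add,
    zero_sub, Nat.cast_add, Nat.cast_one, mismatch_of_ne (hR.right 0 (by simp)).symm] at hle
  rw [base_rotate_zero]
  unfold base consume
  rw [Nat.cast_zero]
  linarith

theorem IsIsolated.reach_consume (h0 : 0 ≤ h) (hs : (s : ℕ) ≠ 1) (hR : R.IsIsolated σ s)
    (hle : mismatch (σ (R.site (-1) 0)) (R.base σ 0) + rowEnergy h (R.base σ) R.m ≤ 2) :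
    Reach h (energy K L q h σ + 2) σ (R.consume σ) := by
  unfold base at hle
  refine reach_sweep_consume h0 hR.perp.neg_right hs hR.width
    (fun i hi => by simpa using hR.eq i (by simpa using hi) 0 (by simp))
    (fun i hi => by simpa using hR.bottom i (by simpa using hi))
    (by simpa using hR.left 0 (by simp)) ?_
  simpa using hle

theorem IsIsolated.two_le_of_extremal (h0 : 0 ≤ h) (hs : (s : ℕ) ≠ 1) (hσ : Extremal h s σ)
    (hR : R.IsIsolated σ s) :
    2 ≤ mismatch (σ (R.site (-1) 0)) (R.base σ 0) + rowEnergy h (R.base σ) R.m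
      + mismatch (R.base σ R.m) (R.rotate.base σ 0) := by
  by_contra! hlt
  have hle := hR.energy_consume_le (h := h) hs
  have := mismatch_nonneg (a := s) (b := σ (R.site 0 1))
  have := mismatch_nonneg (a := R.base σ R.m) (b := R.rotate.base σ 0)
  linarith [hσ.energy_le (hR.reach_consume h0 hs (by linarith))]

theorem consume_site_zero {i : ℕ} (hi : i ≤ R.m) : R.consume σ (R.site i 0) = R.base σ i := by
  have := sweep_apply (σ := σ) (x := R.site 0 0) (e := R.e) (p := -R.f) (Nat.lt_succ_of_le hi)
  simpa [base, consume] using this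

theorem consume_site_of_pos (hR : Perp R.e R.f) (i : ℤ) {j : ℤ} (hj : 0 < j)
    (hj' : j < addOrderOf R.f) : R.consume σ (R.site i j) = σ (R.site i j) := by
  refine sweep_of_ne fun k _ heq => ?_
  have hzero : j • R.f = 0 := by
    refine hR.symm.zsmul_eq_zero (j := i - k) ?_
    rw [site_add_nsmul_e, ← sub_eq_zero] at heq
    rw [← heq, site, site]
    simp only [sub_smul, add_smul, zero_smul]
    abel
  exact (Int.le_of_dvd hj (addOrderOf_dvd_iff_zsmul_eq_zero.2 hzero)).not_gt hj'

/-- The rectangle without its lowest row; meaningful only for `n ≠ 0`. -/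
@[simps]
def upper (R : Rectangle (Fin K × Fin L)) : Rectangle (Fin K × Fin L) :=
  ⟨R.origin + R.f, R.e, R.f, R.m, R.n - 1⟩

@[simp]
theorem site_upper (i j : ℤ) : R.upper.site i j = R.site i (j + 1) := by
  simp only [site, upper, add_smul, one_smul]
  abel

theorem IsIsolated.consume (hR : R.IsIsolated σ s) (hn : R.n ≠ 0) :
    R.upper.IsIsolated (R.consume σ) s := by
  have hn' : ((R.n - 1 : ℕ) : ℤ) = R.n - 1 := by omega
  have hkeep (i : ℤ) {j : ℤ} (hj : 0 < j) (hjn : j ≤ R.n + 1) :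
      R.consume σ (R.site i j) = σ (R.site i j) :=
    consume_site_of_pos hR.perp i hj (by have := hR.height; omega)
  refine ⟨⟨hR.perp, fun i hi j hj => ?_⟩, hR.width, ?_, fun i hi => ?_, fun i hi => ?_,
    fun j hj => ?_, fun j hj => ?_⟩
  all_goals simp only [upper_m, upper_n, upper_f, hn', site_upper, Set.mem_Icc] at *
  · rw [hkeep _ (by omega) (by omega)]
    exact hR.eq _ hi _ (by simp; omega)
  · have := hR.height; omega
  · lift i to ℕ using hi.1
    rw [neg_add_cancel, consume_site_zero (by omega)]
    exact hR.bottom i (by simpa using hi.2)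
  · rw [hkeep _ (by omega) (by omega), sub_add_cancel]
    exact hR.top _ hi
  · rw [hkeep _ (by omega) (by omega)]
    exact hR.left _ (by simp; omega)
  · rw [hkeep _ (by omega) (by omega)]
    exact hR.right _ (by simp; omega)

theorem IsIsolated.reach_and_energy_consume_le (h0 : 0 ≤ h) (hs : (s : ℕ) ≠ 1)
    (hb1 : (b : ℕ) ≠ 1) (hR : R.IsIsolated σ s) (hb : ∀ i ≤ R.m, R.base σ i = b) :
    Reach h (energy K L q h σ + 2) σ (R.consume σ) ∧
      energy K L q h (R.consume σ) ≤ energy K L q h σ - mismatch s (σ (R.site 0 1)) := by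
  have hrow : rowEnergy h (R.base σ) R.m = 0 := by
    rw [rowEnergy_const h hb, oneIndicator_of_ne hb1, mul_zero, mul_zero]
  have hl := mismatch_le_one (a := σ (R.site (-1) 0)) (b := R.base σ 0)
  have hr := mismatch_le_one (a := R.base σ R.m) (b := R.rotate.base σ 0)
  have hle := hR.energy_consume_le (h := h) hs
  exact ⟨hR.reach_consume h0 hs (by linarith), by linarith⟩

theorem IsIsolated.exists_energy_lt (h0 : 0 ≤ h) (hs : (s : ℕ) ≠ 1) (hb1 : (b : ℕ) ≠ 1)
    (hR : R.IsIsolated σ s) (hb : ∀ i ≤ R.m, R.base σ i = b) :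
    ∃ τ, Reach h (energy K L q h σ + 2) σ τ ∧ energy K L q h τ < energy K L q h σ := by
  induction hn : R.n generalizing σ R with
  | zero =>
    have htop := hR.top 0 (by simp)
    rw [hn, Nat.cast_zero, zero_add] at htop
    obtain ⟨hreach, hle⟩ := hR.reach_and_energy_consume_le h0 hs hb1 hb
    rw [mismatch_of_ne htop.symm] at hle
    exact ⟨_, hreach, by linarith⟩
  | succ n ih =>
    obtain ⟨hreach, hle⟩ := hR.reach_and_energy_consume_le (h := h) h0 hs hb1 hb
    have hle' : energy K L q h (R.consume σ) ≤ energy K L q h σ := by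
      linarith [mismatch_nonneg (a := s) (b := σ (R.site 0 1))]
    have hupper : R.upper.IsIsolated (R.consume σ) s := hR.consume (by omega)
    have hb' (i : ℕ) (hi : i ≤ R.upper.m) : R.upper.base (R.consume σ) i = b := by
      rw [← hb i hi, ← consume_site_zero (R := R) hi]
      simp [base]
    obtain ⟨τ, hr, hlt⟩ := ih hupper hb' (by simp [hn])
    exact ⟨τ, hreach.trans (hr.mono (by linarith)), by linarith⟩

end Rectangle

/-- The index `i` runs through the sides of a rectangle, met in turn while walking around it: `x i`
and `y i` are the first and the last spin outside side `i`, `z i` is the spin outside the corner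
before it, and `t i` is the energy of the row of spins from `x i` to `y i`. If side `i` cannot grow,
`hgrow i` holds; if it cannot be consumed, `hconsume` does. -/
theorem false_of_grow_of_consume {α : Type*} {a : α} {x y z : ℕ → α} {t : ℕ → ℝ}
    (hgrow : ∀ i, mismatch (z i) (x i) + t i + mismatch (y i) (z (i + 1)) < 2)
    (hconsume : ∀ i, 2 ≤ mismatch (y i) (x (i + 1)) + t (i + 1)
      + mismatch (y (i + 1)) (x (i + 2)))
    (hconst : ∀ i, t i < 1 → x i = a ∧ y i = a) : False := by
  have hy (i : ℕ) (hi : 1 ≤ t i) : y i = z (i + 1) := eq_of_mismatch_lt_one (by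
    linarith [hgrow i, mismatch_nonneg (a := z i) (b := x i)])
  have hx (i : ℕ) (hi : 1 ≤ t i) : z i = x i := eq_of_mismatch_lt_one (by
    linarith [hgrow i, mismatch_nonneg (a := y i) (b := z (i + 1))])
  have hlarge (i : ℕ) : 1 ≤ t (i + 1) := by
    by_contra! hlt
    obtain ⟨hxa, hya⟩ := hconst _ hlt
    have hl : mismatch (y i) (x (i + 1)) ≤ mismatch (z (i + 1)) (x (i + 1)) := by
      rcases lt_or_ge (t i) 1 with hi | hi
      · rw [(hconst i hi).2, hxa, mismatch_self]
        exact mismatch_nonneg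
      · rw [hy i hi]
    have hr : mismatch (y (i + 1)) (x (i + 2)) ≤ mismatch (y (i + 1)) (z (i + 2)) := by
      rcases lt_or_ge (t (i + 2)) 1 with hi | hi
      · rw [(hconst _ hi).1, hya, mismatch_self]
        exact mismatch_nonneg
      · rw [hx _ hi]
    linarith [hgrow (i + 1), hconsume i]
  have h1 := hconsume 1
  rw [hy 1 (hlarge 0), ← hx 3 (hlarge 2)] at h1
  linarith [hgrow 2]

section Maximal

open Rectangle

variable {K L q : ℕ} {h : ℝ} {s : Spin q} {σ : Config K L q} {R : Rectangle (Fin K × Fin L)}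
  [Fact (3 ≤ K)] [Fact (3 ≤ L)]

theorem Extremal.not_isIsolated (h0 : 0 ≤ h) (hs : (s : ℕ) ≠ 1) (hσ : Extremal h s σ) :
    ¬ R.IsIsolated σ s := by
  intro hR
  have hsucc (i : ℕ) : Rectangle.rotate^[i + 1] R = (Rectangle.rotate^[i] R).rotate :=
    Function.iterate_succ_apply' ..
  have hiso (i : ℕ) : (Rectangle.rotate^[i] R).IsIsolated σ s := by
    induction i with
    | zero => exact hR
    | succ i ih => rw [hsucc]; exact ih.rotate
  have hq : 1 ∈ Finset.Icc 1 q := Finset.left_mem_Icc.2 (Finset.nonempty_Icc.1 ⟨s, s.2⟩)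
  refine false_of_grow_of_consume (a := (⟨1, hq⟩ : Spin q))
    (x := fun i => (Rectangle.rotate^[i] R).base σ 0)
    (y := fun i => (Rectangle.rotate^[i] R).base σ (Rectangle.rotate^[i] R).m)
    (z := fun i => (Rectangle.rotate^[i] R).corner σ)
    (t := fun i => rowEnergy h ((Rectangle.rotate^[i] R).base σ) (Rectangle.rotate^[i] R).m)
    (fun i => ?_) (fun i => ?_) fun i hi => ?_
  · rw [hsucc]
    exact (hiso i).rowEnergy_base_lt h0 hs hσ
  · have hle := (hiso (i + 1)).two_le_of_extremal h0 hs hσ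
    rw [← hsucc (i + 1), hsucc i] at hle
    simpa [Rectangle.base, hsucc] using hle
  · have hbase := fun j hj => eq_of_rowEnergy_lt_one h0 hi (i := j) hj
    suffices hone : ((Rectangle.rotate^[i] R).base σ 0 : ℕ) = 1 by
      exact ⟨Subtype.ext hone, (hbase _ le_rfl).trans (Subtype.ext hone)⟩
    by_contra hb
    obtain ⟨τ, hr, hlt⟩ := (hiso i).exists_energy_lt h0 hs hb hbase
    exact hlt.not_ge (hσ.energy_le hr)

theorem Rectangle.IsFilled.width_lt (h0 : 0 ≤ h) (hs : (s : ℕ) ≠ 1) (hσ : Extremal h s σ)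
    (hR : R.IsFilled σ s) {v : Fin K × Fin L} (hv : σ v ≠ s) : R.m + 1 < addOrderOf R.e := by
  by_contra! hle
  refine hv (hσ.eq_const_of_line h0 hs hR.perp (x := R.origin) (fun i => ?_) v)
  have hlt := Nat.mod_lt i (by have := hR.perp.three_le_addOrderOf; omega : 0 < addOrderOf R.e)
  have hi := hR.eq (i % addOrderOf R.e : ℕ) (by simp; omega) 0 (by simp)
  rwa [site, zero_smul, add_zero, natCast_zsmul, mod_addOrderOf_nsmul] at hi

theorem Rectangle.IsFilled.bottom_ne (h0 : 0 ≤ h) (hs : (s : ℕ) ≠ 1) (hσ : Extremal h s σ)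
    (hR : R.IsFilled σ s)
    (hmax : ∀ R' : Rectangle (Fin K × Fin L), R'.IsFilled σ s → R'.m + R'.n ≤ R.m + R.n) :
    ∀ i ∈ Set.Icc (0 : ℤ) R.m, σ (R.site i (-1)) ≠ s := by
  have hside : ∀ i ≤ R.m, σ (R.site 0 (-1) + i • R.e + R.f) = s := fun i hi => by
    simpa using hR.eq i (by simpa using hi) 0 (by simp)
  intro i hi
  lift i to ℕ using hi.1
  rcases hσ.eq_or_ne_of_side h0 hs hR.perp hside with hrow | hrow
  · have hsite (i j : ℤ) :
        (⟨R.origin - R.f, R.e, R.f, R.m, R.n + 1⟩ : Rectangle _).site i j = R.site i (j - 1) := by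
      simp only [site, sub_smul, one_smul]
      abel
    have := hmax ⟨R.origin - R.f, R.e, R.f, R.m, R.n + 1⟩ ⟨hR.perp, fun i hi j hj => ?_⟩
    · simp at this
    · rw [hsite]
      rcases hj.1.eq_or_lt with rfl | hpos
      · lift i to ℕ using hi.1
        simpa using hrow i (by simpa using hi)
      · exact hR.eq _ hi _ (by simp at hj ⊢; omega)
  · simpa using hrow i (by simpa using hi)

theorem Extremal.exists_isFilled_forall_le (h0 : 0 ≤ h) (hs : (s : ℕ) ≠ 1) (hσ : Extremal h s σ)
    {v₀ v : Fin K × Fin L} (hv₀ : σ v₀ = s) (hv : σ v ≠ s) :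
    ∃ R : Rectangle (Fin K × Fin L), R.IsFilled σ s ∧
      ∀ R' : Rectangle (Fin K × Fin L), R'.IsFilled σ s → R'.m + R'.n ≤ R.m + R.n := by
  let sizes : Set ℕ := {k | ∃ R : Rectangle (Fin K × Fin L), R.IsFilled σ s ∧ R.m + R.n = k}
  have hbdd : BddAbove sizes := by
    refine ⟨2 * Fintype.card (Fin K × Fin L), ?_⟩
    rintro _ ⟨R, hR, rfl⟩
    have hwidth := hR.width_lt h0 hs hσ hv
    have hheight : R.n + 1 < addOrderOf R.f := hR.rotate.width_lt h0 hs hσ hv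
    have := addOrderOf_le_card_univ (x := R.e)
    have := addOrderOf_le_card_univ (x := R.f)
    omega
  have hpoint : IsFilled ⟨v₀, unitX K L, unitY K L, 0, 0⟩ σ s := by
    refine ⟨perp_unitX_unitY, fun i hi j hj => ?_⟩
    obtain rfl : i = 0 := by simpa using hi
    obtain rfl : j = 0 := by simpa using hj
    simpa [site] using hv₀
  have hne : sizes.Nonempty := ⟨0, _, hpoint, rfl⟩
  obtain ⟨R, hR, hmax⟩ := Nat.sSup_mem hne hbdd
  exact ⟨R, hR, fun R' hR' => hmax ▸ le_csSup hbdd ⟨R', hR', rfl⟩⟩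

theorem Extremal.eq_const (h0 : 0 ≤ h) (hs : (s : ℕ) ≠ 1) (hσ : Extremal h s σ)
    {v₀ : Fin K × Fin L} (hv₀ : σ v₀ = s) (v : Fin K × Fin L) : σ v = s := by
  by_contra hv
  obtain ⟨R, hR, hmax⟩ := hσ.exists_isFilled_forall_le h0 hs hv₀ hv
  have hmax' (R' : Rectangle (Fin K × Fin L)) (hR' : R'.IsFilled σ s) :
      R'.m + R'.n ≤ R.n + R.m := (hmax R' hR').trans_eq (add_comm ..)
  refine hσ.not_isIsolated h0 hs (R := R) ⟨hR, hR.width_lt h0 hs hσ hv,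
    hR.rotate.width_lt h0 hs hσ hv, hR.bottom_ne h0 hs hσ hmax, fun i hi => ?_, fun j hj => ?_,
    fun j hj => ?_⟩
  · simpa using hR.rotate.rotate.bottom_ne h0 hs hσ hmax (R.m - i) (by simp_all)
  · simpa using hR.rotate.rotate.rotate.bottom_ne h0 hs hσ hmax' (R.n - j) (by simp_all)
  · simpa using hR.rotate.bottom_ne h0 hs hσ hmax' j hj

end Maximal

section Descent

variable {K L q : ℕ} {h : ℝ} {a s : Spin q} {σ : Config K L q} {v : Fin K × Fin L}

theorem exists_ne_one (ha : (a : ℕ) = 1) (hσ : σ ≠ fun _ => a) : ∃ v, (σ v : ℕ) ≠ 1 := by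
  by_contra! hall
  exact hσ (funext fun v => Subtype.ext ((hall v).trans ha.symm))

variable [Fact (3 ≤ K)] [Fact (3 ≤ L)]

theorem mem_stableStates_of_eq_const (h0 : 0 ≤ h) (hs : (s : ℕ) ≠ 1) (hσ : ∀ v, σ v = s) :
    σ ∈ Landscape.stableStates (energy K L q h) := by
  obtain rfl : σ = fun _ => s := funext hσ
  refine ⟨trivial, fun τ _ => ?_⟩
  simp only [energy_eq, mismatch_self, oneIndicator_of_ne hs, Finset.sum_const_zero, mul_zero]
  have hX : 0 ≤ ∑ v, mismatch (τ v) (τ (v + unitX K L)) :=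
    Finset.sum_nonneg fun _ _ => mismatch_nonneg
  have hY : 0 ≤ ∑ v, mismatch (τ v) (τ (v + unitY K L)) :=
    Finset.sum_nonneg fun _ _ => mismatch_nonneg
  have hone : 0 ≤ ∑ v, oneIndicator (τ v) := Finset.sum_nonneg fun _ _ => oneIndicator_nonneg
  linarith [mul_nonneg h0 hone]

theorem exists_reach_energy_lt (h0 : 0 ≤ h)
    (hσ : σ ∉ Landscape.stableStates (energy K L q h)) (hv : (σ v : ℕ) ≠ 1) :
    ∃ τ, Reach h (energy K L q h σ + 2) σ τ ∧ energy K L q h τ < energy K L q h σ := by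
  refine (Landscape.exists_lower_or_exists_isExtremal (spinCount (σ v)) σ).resolve_right ?_
  rintro ⟨η, heq, hcount, hη⟩
  obtain ⟨w, hw⟩ : ∃ w, η w = σ v := by
    have hpos : 0 < spinCount (σ v) σ := Finset.card_pos.2 ⟨v, by simp⟩
    obtain ⟨w, hw⟩ := Finset.card_pos.1 (hpos.trans_le hcount)
    exact ⟨w, by simpa using hw⟩
  have hstable := mem_stableStates_of_eq_const h0 hv (Extremal.eq_const h0 hv hη hw)
  exact hσ ⟨trivial, fun τ hτ => heq ▸ hstable.2 τ hτ⟩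

theorem exists_reach_stableStates (h0 : 0 ≤ h) (ha : (a : ℕ) = 1)
    (hlt : energy K L q h σ < energy K L q h (fun _ => a)) :
    ∃ η ∈ Landscape.stableStates (energy K L q h), Reach h (energy K L q h σ + 2) σ η := by
  refine Landscape.exists_reachable_stableStates fun τ hτ hle => ?_
  obtain ⟨v, hv⟩ := exists_ne_one ha (σ := τ) fun heq => (heq ▸ hle).not_gt hlt
  exact exists_reach_energy_lt h0 hτ hv

end Descent

section Droplet

variable {K L q : ℕ} {h : ℝ} {a s : Spin q} {e f : Fin K × Fin L} {k m n : ℕ}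

/-- The energy cost, above the configuration of constant spin `1`, of an `ℓ × (ℓ - 1)` rectangle
of another spin with a single further vertex attached to a side of length `ℓ`. -/
noncomputable def barrierHeight (h : ℝ) (ℓ : ℕ) : ℝ := 4 * ℓ - h * (ℓ * (ℓ - 1) + 1)

open Classical in
/-- The droplet of spin `s` filling the vertices `i • e + j • f` with `i < m` and `j < n`, in a sea
of spins `a`. -/
noncomputable def droplet [NeZero K] [NeZero L] (a s : Spin q) (e f : Fin K × Fin L) (m n : ℕ) :
    Config K L q :=
  fun v => if ∃ i < m, ∃ j < n, v = i • e + j • f then s else a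

variable [Fact (3 ≤ K)] [Fact (3 ≤ L)]

theorem droplet_comm : droplet a s e f m n = droplet a s f e n m := by
  funext v
  unfold droplet
  congr 1
  exact propext ⟨fun ⟨i, hi, j, hj, hv⟩ => ⟨j, hj, i, hi, hv.trans (add_comm ..)⟩,
    fun ⟨j, hj, i, hi, hv⟩ => ⟨i, hi, j, hj, hv.trans (add_comm ..)⟩⟩

theorem droplet_zero : droplet a s e f 0 n = fun _ => a := by
  funext v
  simp [droplet]

theorem droplet_one_one : droplet a s e f 1 1 = Function.update (fun _ => a) 0 s := by
  funext v
  simp [droplet, Function.update_apply]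

theorem droplet_side (hk : k < m) (hn : 1 ≤ n) :
    droplet a s e f m n (n • f + k • e + -f) = s := by
  refine if_pos ⟨k, hk, n - 1, by omega, ?_⟩
  nth_rw 1 [← Nat.sub_add_cancel hn]
  rw [succ_nsmul]
  abel

theorem droplet_line (hef : Perp e f) (hn : n < addOrderOf f) :
    droplet a s e f m n (n • f + k • e) = a := by
  refine if_neg ?_
  rintro ⟨i, -, j, hj, heq⟩
  have hzero : ((n - j : ℕ) : ℤ) • f = 0 := by
    refine hef.symm.zsmul_eq_zero (j := (k : ℤ) - i) ?_
    rw [Nat.cast_sub hj.le]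
    simp only [sub_smul, natCast_zsmul]
    rw [← sub_eq_zero.2 heq]
    abel
  rw [natCast_zsmul] at hzero
  have := Nat.le_of_dvd (by omega) (addOrderOf_dvd_of_nsmul_eq_zero hzero)
  omega

theorem sweep_droplet (hn : 1 ≤ n) :
    sweep (droplet a s e f m n) (n • f) e (-f) m = droplet a s e f m (n + 1) := by
  funext v
  by_cases hv : ∃ i < m, v = n • f + i • e
  · obtain ⟨i, hi, rfl⟩ := hv
    rw [sweep_apply hi, droplet_side hi hn]
    exact (if_pos ⟨i, hi, n, n.lt_succ_self, add_comm ..⟩).symm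
  · push Not at hv
    rw [sweep_of_ne hv]
    unfold droplet
    congr 1
    refine propext ⟨fun ⟨i, hi, j, hj, h⟩ => ⟨i, hi, j, by omega, h⟩, ?_⟩
    rintro ⟨i, hi, j, hj, rfl⟩
    refine ⟨i, hi, j, (Nat.le_of_lt_succ hj).lt_of_ne ?_, rfl⟩
    rintro rfl
    exact hv i hi (add_comm ..)

theorem energy_sweep_droplet_le (hef : Perp e f) (ha : (a : ℕ) = 1) (hs : (s : ℕ) ≠ 1)
    (hm : m < addOrderOf e) (hn1 : 1 ≤ n) (hn : n < addOrderOf f) (hk : k < m) :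
    energy K L q h (sweep (droplet a s e f m n) (n • f) e (-f) (k + 1))
      ≤ energy K L q h (droplet a s e f m n) + 2 - h * (k + 1) := by
  have hexpand := energy_sweep_expand_le (h := h) (σ := droplet a s e f m n) (x := n • f)
    hef.neg_right hs (m := k) (by omega) (fun i hi => droplet_side (by omega) hn1) fun i _ => by
      rw [droplet_line hef hn]
      exact fun has => hs (has ▸ ha)
  rw [rowEnergy_const h fun i _ => droplet_line hef hn, oneIndicator_of_eq ha, mul_one] at hexpand
  have hprev := mismatch_nonneg (a := droplet a s e f m n (n • f - e))
    (b := droplet a s e f m n (n • f))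
  have hnext := mismatch_nonneg (a := droplet a s e f m n (n • f + k • e))
    (b := droplet a s e f m n (n • f + (k + 1) • e))
  linarith

theorem energy_droplet_succ_le (hef : Perp e f) (ha : (a : ℕ) = 1) (hs : (s : ℕ) ≠ 1)
    (hm1 : 1 ≤ m) (hm : m < addOrderOf e) (hn1 : 1 ≤ n) (hn : n < addOrderOf f) :
    energy K L q h (droplet a s e f m (n + 1))
      ≤ energy K L q h (droplet a s e f m n) + 2 - h * m := by
  obtain ⟨k, rfl⟩ := Nat.exists_eq_add_of_le' hm1
  rw [← sweep_droplet hn1, Nat.cast_succ]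
  exact energy_sweep_droplet_le hef ha hs hm hn1 hn k.lt_succ_self

theorem reach_droplet_succ (h0 : 0 ≤ h) (hef : Perp e f) (ha : (a : ℕ) = 1) (hs : (s : ℕ) ≠ 1)
    (hm : m < addOrderOf e) (hn1 : 1 ≤ n) (hn : n < addOrderOf f) {C : ℝ}
    (hC : energy K L q h (droplet a s e f m n) + 2 - h ≤ C) :
    Reach h C (droplet a s e f m n) (droplet a s e f m (n + 1)) := by
  rw [← sweep_droplet hn1]
  refine reach_sweep fun k hk => (energy_sweep_droplet_le hef ha hs hm hn1 hn hk).trans ?_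
  linarith [mul_nonneg h0 k.cast_nonneg]

theorem energy_droplet_one_one (h : ℝ) (hef : Perp e f) (ha : (a : ℕ) = 1) (hs : (s : ℕ) ≠ 1) :
    energy K L q h (droplet a s e f 1 1) = energy K L q h (fun _ => a) + 4 - h := by
  have hsa : s ≠ a := fun hsa => hs (hsa ▸ ha)
  have hflip := energy_update h hef (fun _ => a) 0 s
  simp only [mismatch_self, mismatch_of_ne hsa, oneIndicator_of_ne hs, oneIndicator_of_eq ha]
    at hflip
  rw [droplet_one_one]
  linarith

theorem energy_droplet_le (hef : Perp e f) (ha : (a : ℕ) = 1) (hs : (s : ℕ) ≠ 1)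
    (hm1 : 1 ≤ m) (hm : m < addOrderOf e) (hn1 : 1 ≤ n) (hn : n < addOrderOf f) :
    energy K L q h (droplet a s e f m n)
      ≤ energy K L q h (fun _ => a) + 2 * (m + n) - h * (m * n) := by
  induction n, hn1 using Nat.le_induction with
  | base =>
    induction m, hm1 using Nat.le_induction with
    | base => rw [energy_droplet_one_one h hef ha hs]; norm_num
    | succ m hm1 ih =>
      have hgrow := energy_droplet_succ_le (h := h) hef.symm ha hs le_rfl hn hm1 (by omega)
      rw [droplet_comm, droplet_comm (m := 1)] at hgrow
      have hm' := ih (by omega)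
      push_cast at hgrow hm' ⊢
      linarith
  | succ n hn1 ih =>
    have hgrow := energy_droplet_succ_le (h := h) hef ha hs hm1 hm hn1 (by omega)
    have hn' := ih (by omega)
    push_cast
    linarith

theorem reach_droplet_square (h0 : 0 ≤ h) (hef : Perp e f) (ha : (a : ℕ) = 1) (hs : (s : ℕ) ≠ 1)
    {Γ : ℝ} (hΓ : ∀ ℓ, barrierHeight h ℓ ≤ Γ) (hne : n < addOrderOf e) (hnf : n < addOrderOf f) :
    Reach h (energy K L q h (fun _ => a) + Γ) (fun _ => a) (droplet a s e f n n) := by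
  induction n with
  | zero => rw [droplet_zero]; exact .refl
  | succ n ih =>
    have hn := hΓ n
    have hn' := hΓ (n + 1)
    unfold barrierHeight at hn hn'
    push_cast at hn hn'
    obtain rfl | hpos := n.eq_zero_or_pos
    · have hone := energy_droplet_one_one (K := K) (L := L) h hef ha hs
      rw [droplet_one_one] at hone ⊢
      exact reach_update (by push_cast at hn'; linarith)
    have hsquare := energy_droplet_le (h := h) hef ha hs hpos (by omega) hpos (by omega : n < _)
    have hlong := energy_droplet_le (h := h) hef ha hs hpos (by omega) n.succ_pos hnf
    push_cast at hlong
    -- the protuberance on the `n × n` square costs the mean of the barriers at `n` and `n + 1`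
    have hright := reach_droplet_succ (m := n) (n := n) h0 hef ha hs (by omega) hpos (by omega)
      (C := energy K L q h (fun _ => a) + Γ) (by linarith)
    have hup := reach_droplet_succ (m := n + 1) (n := n) h0 hef.symm ha hs hnf hpos (by omega)
      (C := energy K L q h (fun _ => a) + Γ) (by rw [droplet_comm]; linarith)
    rw [droplet_comm, droplet_comm (m := n + 1)] at hup
    exact ((ih (by omega) (by omega)).trans hright).trans hup

end Droplet

section MixedLines

variable {α β ι : Type*} {n : ℕ}

theorem exists_and_not_add_one [NeZero n] {P : Fin n → Prop} (hP : ∃ x, P x) (hnP : ∃ x, ¬ P x) :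
    ∃ x, P x ∧ ¬ P (x + 1) := by
  by_contra! hstep
  obtain ⟨x, hx⟩ := hP
  obtain ⟨y, hy⟩ := hnP
  have hall (i : ℕ) : P (x + i • 1) := by
    induction i with
    | zero => simpa using hx
    | succ i ih => rw [succ_nsmul, ← add_assoc]; exact hstep _ ih
  apply hy
  simpa [val_nsmul_one_self] using hall (y - x).val

theorem two_le_sum_mismatch [NeZero n] {g : Fin n → α} {P : α → Prop} (hP : ∃ x, P (g x))
    (hnP : ∃ x, ¬ P (g x)) : 2 ≤ ∑ x, mismatch (g x) (g (x + 1)) := by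
  obtain ⟨x, hx, hx'⟩ := exists_and_not_add_one hP hnP
  obtain ⟨y, hy, hy'⟩ := exists_and_not_add_one (P := fun x => ¬ P (g x)) hnP (by simpa using hP)
  have hxy : x ≠ y := fun hxy => hy (hxy ▸ hx)
  have hmx : mismatch (g x) (g (x + 1)) = 1 := mismatch_of_ne fun heq => hx' (heq ▸ hx)
  have hmy : mismatch (g y) (g (y + 1)) = 1 :=
    mismatch_of_ne fun heq => hy' fun hP' => hy (heq ▸ hP')
  calc (2 : ℝ) = ∑ z ∈ {x, y}, mismatch (g z) (g (z + 1)) := by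
        rw [Finset.sum_pair hxy, hmx, hmy]; norm_num
    _ ≤ ∑ x, mismatch (g x) (g (x + 1)) :=
        Finset.sum_le_sum_of_subset_of_nonneg (Finset.subset_univ _)
          fun _ _ _ => mismatch_nonneg

open Classical in
/-- The number of lines `b` along which `P` neither holds everywhere nor fails everywhere. -/
noncomputable def mixedCount [Fintype β] (P : β → α → Prop) : ℕ :=
  (Finset.univ.filter fun b => (∃ a, P b a) ∧ ∃ a, ¬ P b a).card

open Classical in
theorem mixedCount_nsmul_le_sum [Fintype β] {P : β → α → Prop} {w : β → ℝ} {c : ℝ}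
    (hw : ∀ b, 0 ≤ w b) (hc : ∀ b, (∃ a, P b a) → (∃ a, ¬ P b a) → c ≤ w b) :
    mixedCount P • c ≤ ∑ b, w b :=
  (Finset.card_nsmul_le_sum _ _ _ fun b hb =>
    hc b (Finset.mem_filter.1 hb).2.1 (Finset.mem_filter.1 hb).2.2).trans
    (Finset.sum_le_sum_of_subset_of_nonneg (Finset.filter_subset _ _) fun b _ _ => hw b)

theorem two_mul_mixedCount_le_sum [Fintype β] [NeZero n] (g : β → Fin n → α) (P : α → Prop) :
    2 * (mixedCount fun b x => P (g b x) : ℝ) ≤ ∑ b, ∑ x, mismatch (g b x) (g b (x + 1)) := by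
  rw [mul_comm, ← nsmul_eq_mul]
  exact mixedCount_nsmul_le_sum (fun _ => Finset.sum_nonneg fun _ _ => mismatch_nonneg)
    fun _ => two_le_sum_mismatch

variable [Fintype α] [Fintype β] {ℓ : ℕ}

/- At most `ℓ / 3` of the lines `b` can be full; every other line is mixed, as it meets the full
transversal line `a₀`. -/
theorem two_mul_le_mixedCount {P : β → α → Prop} {S : Finset (β × α)}
    (hα : 3 * ℓ ≤ Fintype.card α) (hβ : 3 * ℓ ≤ Fintype.card β)
    (hS : ∀ b a, P b a → (b, a) ∈ S) (hcard : S.card ≤ ℓ ^ 2) {a₀ : α} (ha₀ : ∀ b, P b a₀) :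
    2 * ℓ ≤ mixedCount P := by
  classical
  let full : Finset β := Finset.univ.filter fun b => ∀ a, P b a
  have harea : full.card * (3 * ℓ) ≤ ℓ ^ 2 := by
    refine (Nat.mul_le_mul_left _ hα).trans ?_
    rw [← Finset.card_univ, ← Finset.card_product]
    refine (Finset.card_le_card fun p hp => hS p.1 p.2 ?_).trans hcard
    simp only [full, Finset.mem_product, Finset.mem_filter, Finset.mem_univ, true_and,
      and_true] at hp
    exact hp p.2
  have hfull : 3 * full.card ≤ ℓ ∨ ℓ = 0 := by
    by_contra! hlt
    nlinarith [Nat.pos_of_ne_zero hlt.2]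
  have hmixed : mixedCount P = (Finset.univ.filter fun b => ¬ ∀ a, P b a).card := by
    rw [mixedCount]
    congr 1
    ext b
    simp only [Finset.mem_filter, not_forall, and_iff_right (⟨a₀, ha₀ b⟩ : ∃ a, P b a)]
  have hsum : full.card + mixedCount P = Fintype.card β := by
    rw [hmixed, Finset.card_filter_add_card_filter_not, Finset.card_univ]
  omega

theorem two_mul_le_mixedCount_add_or_card_le {P : α → β → Prop} {S : Finset (α × β)}
    (hα : 3 * ℓ ≤ Fintype.card α) (hβ : 3 * ℓ ≤ Fintype.card β)
    (hS : ∀ p, p ∈ S ↔ P p.1 p.2) (hcard : S.card ≤ ℓ ^ 2) :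
    2 * ℓ ≤ mixedCount P + mixedCount (Function.swap P) ∨
      S.card ≤ mixedCount P * mixedCount (Function.swap P) := by
  classical
  by_cases hcol : ∃ b, ∀ a, P a b
  · obtain ⟨b, hb⟩ := hcol
    have := two_mul_le_mixedCount (P := P) hβ hα (fun a b hab => (hS (a, b)).2 hab) hcard hb
    omega
  by_cases hrow : ∃ a, ∀ b, P a b
  · obtain ⟨a, ha⟩ := hrow
    have := two_mul_le_mixedCount (P := Function.swap P) hα hβ
      (S := S.map (Equiv.prodComm α β).toEmbedding)
      (fun b a hab => by simpa [hS] using hab) (by simpa using hcard) ha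
    omega
  push Not at hcol hrow
  right
  rw [mixedCount, mixedCount, ← Finset.card_product]
  refine Finset.card_le_card fun p hp => ?_
  have hp' := (hS p).1 hp
  simp only [Finset.mem_product, Finset.mem_filter, Finset.mem_univ, true_and]
  exact ⟨⟨⟨p.2, hp'⟩, hrow p.1⟩, ⟨p.1, hp'⟩, hcol p.2⟩

end MixedLines

section Area

variable {K L q ℓ : ℕ} {h : ℝ} {a : Spin q} {σ η : Config K L q}

/-- The number of vertices of spin different from `1`. -/
def area (σ : Config K L q) : ℕ :=
  (Finset.univ.filter fun v => (σ v : ℕ) ≠ 1).card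

/-- The number of rows and columns containing both a vertex of spin `1` and one of another spin:
a lower bound for half the perimeter of the region of spin different from `1`. -/
noncomputable def mixedLines (σ : Config K L q) : ℕ :=
  mixedCount (fun x y => (σ (x, y) : ℕ) ≠ 1) + mixedCount fun y x => (σ (x, y) : ℕ) ≠ 1

theorem two_mul_le_mixedLines_or_four_mul_area_le (hK : 3 * ℓ ≤ K) (hL : 3 * ℓ ≤ L)
    (hσ : area σ ≤ ℓ ^ 2) : 2 * ℓ ≤ mixedLines σ ∨ 4 * area σ ≤ mixedLines σ ^ 2 := by
  refine (two_mul_le_mixedCount_add_or_card_le (P := fun x y => (σ (x, y) : ℕ) ≠ 1)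
    (by simpa using hK) (by simpa using hL) (fun p => by simp) hσ).imp_right fun hle => ?_
  calc 4 * area σ ≤ 4 * (_ * _) := Nat.mul_le_mul_left 4 hle
    _ = 4 * _ * _ := (mul_assoc ..).symm
    _ ≤ mixedLines σ ^ 2 := four_mul_le_sq_add ..

theorem area_le_add_one (hση : 0 < connectivity K L q σ η) : area η ≤ area σ + 1 := by
  have hcard : (Finset.univ.filter fun v => σ v ≠ η v).card = 1 := by
    by_contra hne
    rw [connectivity, if_neg hne] at hση
    exact hση.false
  rw [← hcard]
  refine (Finset.card_le_card fun v hv => ?_).trans (Finset.card_union_le _ _)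
  simp only [Finset.mem_union, Finset.mem_filter, Finset.mem_univ, true_and] at hv ⊢
  obtain heq | hne := eq_or_ne (σ v) (η v)
  · exact Or.inl (heq ▸ hv)
  · exact Or.inr hne

theorem exists_area_eq {n : ℕ} (hσ : area σ < n) (hη : n ≤ area η)
    (ω : Landscape.Path (connectivity K L q) σ η) : ∃ i, area (ω.state i) = n := by
  by_contra! hne
  have hlt (i) : area (ω.state i) < n := by
    induction i using Fin.induction with
    | zero => rwa [ω.source]
    | succ i ih => exact lt_of_le_of_ne ((area_le_add_one (ω.step i)).trans ih) (hne _)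
  exact hη.not_gt (ω.target ▸ hlt (Fin.last _))

variable [Fact (3 ≤ K)] [Fact (3 ≤ L)]

theorem two_mul_mixedLines_le (h : ℝ) (ha : (a : ℕ) = 1) (σ : Config K L q) :
    2 * (mixedLines σ : ℝ)
      ≤ energy K L q h σ - energy K L q h (fun _ => a) + h * area σ := by
  have harea : (area σ : ℝ) = ∑ v, (oneIndicator a - oneIndicator (σ v)) := by
    rw [area, Finset.card_eq_sum_ones, Nat.cast_sum, Finset.sum_filter]
    refine Finset.sum_congr rfl fun v _ => ?_
    by_cases hv : (σ v : ℕ) = 1 <;> simp [oneIndicator, hv, ha]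
  have hX : ∑ v, mismatch (σ v) (σ (v + unitX K L))
      = ∑ y, ∑ x, mismatch (σ (x, y)) (σ (x + 1, y)) := by
    rw [Fintype.sum_prod_type_right]
    simp
  have hY : ∑ v, mismatch (σ v) (σ (v + unitY K L))
      = ∑ x, ∑ y, mismatch (σ (x, y)) (σ (x, y + 1)) := by
    rw [Fintype.sum_prod_type]
    simp
  have hcols := two_mul_mixedCount_le_sum (fun x y => σ (x, y)) fun s : Spin q => (s : ℕ) ≠ 1
  have hrows := two_mul_mixedCount_le_sum (fun y x => σ (x, y)) fun s : Spin q => (s : ℕ) ≠ 1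
  rw [harea, Finset.sum_sub_distrib, energy_eq, energy_eq, hX, hY, mixedLines]
  simp only [mismatch_self, Finset.sum_const_zero]
  push_cast
  linarith

theorem energy_const_le_of_area_le (h0 : 0 ≤ h) (h2 : h < 2) (hℓ1 : 1 ≤ ℓ)
    (hℓ : (ℓ - 1) * h ≤ 2) (hK : 3 * ℓ ≤ K) (hL : 3 * ℓ ≤ L) (ha : (a : ℕ) = 1)
    (hσ : area σ ≤ ℓ * (ℓ - 1)) : energy K L q h (fun _ => a) ≤ energy K L q h σ := by
  have hperimeter := two_mul_mixedLines_le h ha σ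
  have hle : area σ ≤ ℓ ^ 2 := hσ.trans (by rw [pow_two]; gcongr; omega)
  suffices h * area σ ≤ 2 * mixedLines σ by linarith
  obtain hlarge | hsmall := le_or_gt (2 * ℓ) (mixedLines σ)
  · have hσ' : (area σ : ℝ) ≤ ℓ * (ℓ - 1) := by
      rw [← Nat.cast_one, ← Nat.cast_sub hℓ1]
      exact_mod_cast hσ
    have hlarge' : (2 : ℝ) * ℓ ≤ mixedLines σ := by exact_mod_cast hlarge
    calc h * area σ ≤ h * (ℓ * (ℓ - 1)) := by gcongr
      _ = ℓ * ((ℓ - 1) * h) := by ring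
      _ ≤ ℓ * 2 := by gcongr
      _ ≤ 2 * mixedLines σ := by linarith
  · have harea : 4 * (area σ : ℝ) ≤ mixedLines σ ^ 2 := by
      exact_mod_cast (two_mul_le_mixedLines_or_four_mul_area_le hK hL hle).resolve_left
        hsmall.not_ge
    have hsmall' : (mixedLines σ : ℝ) ≤ 2 * ℓ := by exact_mod_cast hsmall.le
    have hslope : h * mixedLines σ ≤ 8 := by
      linarith [mul_le_mul_of_nonneg_left hsmall' h0]
    have := mul_le_mul_of_nonneg_left harea h0
    have := mul_le_mul_of_nonneg_right hslope (mixedLines σ).cast_nonneg (α := ℝ)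
    linarith

theorem barrierHeight_le_of_area_eq (hℓ1 : 1 ≤ ℓ) (hK : 3 * ℓ ≤ K) (hL : 3 * ℓ ≤ L)
    (ha : (a : ℕ) = 1) (hσ : area σ = ℓ * (ℓ - 1) + 1) :
    energy K L q h (fun _ => a) + barrierHeight h ℓ ≤ energy K L q h σ := by
  obtain ⟨k, rfl⟩ := Nat.exists_eq_add_of_le' hℓ1
  rw [Nat.add_sub_cancel] at hσ
  have hlines : 2 * (k + 1) ≤ mixedLines σ := by
    refine (two_mul_le_mixedLines_or_four_mul_area_le hK hL (by rw [hσ]; nlinarith)).elim id ?_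
    intro hsq
    by_contra! hlt
    have := Nat.pow_le_pow_left (Nat.le_of_lt_succ hlt : mixedLines σ ≤ 2 * k + 1) 2
    rw [hσ] at hsq
    nlinarith
  have hlines' : 2 * ((k : ℝ) + 1) ≤ mixedLines σ := by exact_mod_cast hlines
  have hperimeter := two_mul_mixedLines_le h ha σ
  rw [hσ] at hperimeter
  rw [barrierHeight]
  push_cast at hperimeter ⊢
  linarith

end Area

section CriticalLength

variable {h : ℝ} {ℓ : ℕ}

theorem two_le_criticalLength_mul (hpos : 0 < h) : 2 ≤ criticalLength h * h :=
  (div_le_iff₀ hpos).1 (Nat.le_ceil _)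

theorem criticalLength_sub_one_mul_le (hpos : 0 < h) : (criticalLength h - 1 : ℝ) * h ≤ 2 := by
  rw [← le_div_iff₀ hpos]
  exact sub_le_iff_le_add.2 (Nat.ceil_lt_add_one (div_nonneg zero_le_two hpos.le)).le

theorem one_le_criticalLength (hpos : 0 < h) : 1 ≤ criticalLength h :=
  Nat.one_le_ceil_iff.2 (by positivity)

theorem barrierHeight_one (h : ℝ) : barrierHeight h 1 = 4 - h := by
  norm_num [barrierHeight]

theorem barrierHeight_le (h0 : 0 ≤ h) (hlo : (ℓ - 1) * h ≤ 2) (hhi : 2 ≤ ℓ * h) (n : ℕ) :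
    barrierHeight h n ≤ barrierHeight h ℓ := by
  have hfactor : barrierHeight h ℓ - barrierHeight h n = (ℓ - n) * (4 - h * (ℓ + n - 1)) := by
    unfold barrierHeight
    ring
  rw [← sub_nonneg, hfactor]
  obtain hn | rfl | hn := lt_trichotomy n ℓ
  · have hn' : (n : ℝ) + 1 ≤ ℓ := by exact_mod_cast hn
    exact mul_nonneg (by linarith) (by linarith [mul_le_mul_of_nonneg_right hn' h0])
  · simp
  · have hn' : (ℓ : ℝ) + 1 ≤ n := by exact_mod_cast hn
    exact mul_nonneg_of_nonpos_of_nonpos (by linarith)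
      (by linarith [mul_le_mul_of_nonneg_right hn' h0])

end CriticalLength

section Metastability

variable {K L q ℓ : ℕ} {h : ℝ} {a s : Spin q} [Fact (3 ≤ K)] [Fact (3 ≤ L)]

theorem le_commHeightSet_const (h0 : 0 ≤ h) (h2 : h < 2) (hℓ1 : 1 ≤ ℓ) (hℓ : (ℓ - 1) * h ≤ 2)
    (hK : 3 * ℓ ≤ K) (hL : 3 * ℓ ≤ L) (ha : (a : ℕ) = 1) :
    ((energy K L q h (fun _ => a) + barrierHeight h ℓ : ℝ) : EReal)
      ≤ Landscape.commHeightSet (energy K L q h) (connectivity K L q) {fun _ => a}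
          (Landscape.lowerStates (energy K L q h) fun _ => a) := by
  refine Landscape.le_commHeightSet fun η hη ω => ?_
  have hlarge : ℓ * (ℓ - 1) < area η := by
    by_contra! hle
    exact (energy_const_le_of_area_le h0 h2 hℓ1 hℓ hK hL ha hle).not_gt hη
  obtain ⟨i, hi⟩ := exists_area_eq (by simp [area, ha]) hlarge ω
  exact ⟨i, barrierHeight_le_of_area_eq hℓ1 hK hL ha hi⟩

theorem exists_reach_energy_lt_const (hpos : 0 < h) (h2 : h < 2) (hlo : (ℓ - 1) * h ≤ 2)
    (hhi : 2 ≤ ℓ * h) (hK : 3 * ℓ ≤ K) (hL : 3 * ℓ ≤ L) (ha : (a : ℕ) = 1)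
    (hs : (s : ℕ) ≠ 1) :
    ∃ σ, Reach h (energy K L q h (fun _ => a) + barrierHeight h ℓ) (fun _ => a) σ ∧
      energy K L q h σ < energy K L q h (fun _ => a) := by
  have hℓ1 : 1 ≤ ℓ := Nat.one_le_iff_ne_zero.2 (by rintro rfl; norm_num at hhi)
  have hX : 3 * ℓ - 1 < addOrderOf (unitX K L) := by rw [addOrderOf_unitX]; omega
  have hY : 3 * ℓ - 1 < addOrderOf (unitY K L) := by rw [addOrderOf_unitY]; omega
  have hΓ := barrierHeight_le hpos.le hlo hhi
  refine ⟨droplet a s (unitX K L) (unitY K L) (3 * ℓ - 1) (3 * ℓ - 1),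
    reach_droplet_square hpos.le perp_unitX_unitY ha hs hΓ hX hY, ?_⟩
  have hle := energy_droplet_le (h := h) perp_unitX_unitY ha hs (by omega) hX (by omega) hY
  have hside : (1 : ℝ) ≤ (3 * ℓ - 1 : ℕ) := by exact_mod_cast (by omega : 1 ≤ 3 * ℓ - 1)
  have hcast : ((3 * ℓ - 1 : ℕ) : ℝ) = 3 * ℓ - 1 := by
    rw [Nat.cast_sub (by omega)]; push_cast; rfl
  have hgain : 4 < h * (3 * ℓ - 1 : ℕ) := by rw [hcast]; linarith
  linarith [mul_lt_mul_of_pos_right hgain (zero_lt_one.trans_le hside)]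

theorem commHeightSet_const_le (hpos : 0 < h) (h2 : h < 2) (hlo : (ℓ - 1) * h ≤ 2)
    (hhi : 2 ≤ ℓ * h) (hK : 3 * ℓ ≤ K) (hL : 3 * ℓ ≤ L) (ha : (a : ℕ) = 1)
    (hs : (s : ℕ) ≠ 1) :
    Landscape.commHeightSet (energy K L q h) (connectivity K L q) {fun _ => a}
        (Landscape.stableStates (energy K L q h))
      ≤ ((energy K L q h (fun _ => a) + barrierHeight h ℓ : ℝ) : EReal) := by
  have hone := barrierHeight_le hpos.le hlo hhi 1
  rw [barrierHeight_one] at hone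
  obtain ⟨σ, hσ, hlt⟩ := exists_reach_energy_lt_const hpos h2 hlo hhi hK hL ha hs
  obtain ⟨η, hη, hση⟩ := exists_reach_stableStates hpos.le ha hlt
  exact Landscape.Reachable.commHeightSet_le (hσ.trans (hση.mono (by linarith))) (by linarith) hη

theorem stabilityLevel_lt_barrierHeight (h0 : 0 ≤ h) (h2 : h < 2) (hlo : (ℓ - 1) * h ≤ 2)
    (hhi : 2 ≤ ℓ * h) (ha : (a : ℕ) = 1) {η : Config K L q}
    (hη : η ∉ Landscape.stableStates (energy K L q h)) (hne : η ≠ fun _ => a) :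
    Landscape.stabilityLevel (energy K L q h) (connectivity K L q) η
      < (barrierHeight h ℓ : EReal) := by
  have hone := barrierHeight_le h0 hlo hhi 1
  rw [barrierHeight_one] at hone
  obtain ⟨v, hv⟩ := exists_ne_one ha hne
  obtain ⟨τ, hr, hlt⟩ := exists_reach_energy_lt h0 hη hv
  exact (hr.stabilityLevel_le zero_le_two hlt).trans_lt (EReal.coe_lt_coe_iff.2 (by linarith))

end Metastability

end Potts

theorem theorem4p4_general {q K L : ℕ} {h : ℝ} (hq : 2 ≤ q) (hpos : 0 < h) (hlt : h < 2)
    (hK : 3 * Potts.criticalLength h ≤ K) (hL : 3 * Potts.criticalLength h ≤ L)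
    {a : Potts.Spin q} (ha : (a : ℕ) = 1) :
    Landscape.metastableStates (Potts.energy K L q h) (Potts.connectivity K L q)
        = {fun _ => a} ∧
    Landscape.stabilityLevel (Potts.energy K L q h) (Potts.connectivity K L q) (fun _ => a)
      = Landscape.barrier (Potts.energy K L q h) (Potts.connectivity K L q) (fun _ => a)
          (Landscape.stableStates (Potts.energy K L q h)) ∧
    Landscape.barrier (Potts.energy K L q h) (Potts.connectivity K L q) (fun _ => a)
        (Landscape.stableStates (Potts.energy K L q h))
      = ((4 * (Potts.criticalLength h : ℝ)
          - h * ((Potts.criticalLength h : ℝ) * ((Potts.criticalLength h : ℝ) - 1) + 1) : ℝ)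
          : EReal) := by
  have hℓ1 := Potts.one_le_criticalLength hpos
  have hlo := Potts.criticalLength_sub_one_mul_le hpos
  have hhi := Potts.two_le_criticalLength_mul hpos
  have : Fact (3 ≤ K) := ⟨by omega⟩
  have : Fact (3 ≤ L) := ⟨by omega⟩
  let s : Potts.Spin q := ⟨2, Finset.mem_Icc.2 ⟨one_le_two, hq⟩⟩
  have hs : (s : ℕ) ≠ 1 := by simp [s]
  obtain ⟨σ, -, hσ⟩ := Potts.exists_reach_energy_lt_const hpos hlt hlo hhi hK hL ha hs
  have hunstable : (fun _ => a) ∉ Landscape.stableStates (Potts.energy K L q h) :=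
    fun hmin => (hmin.2 σ trivial).not_gt hσ
  obtain ⟨hstab, hbar⟩ := Landscape.stabilityLevel_eq_and_barrier_eq hunstable
    (Potts.le_commHeightSet_const hpos.le hlt hℓ1 hlo hK hL ha)
    (Potts.commHeightSet_const_le hpos hlt hlo hhi hK hL ha hs)
  refine ⟨Landscape.metastableStates_eq_singleton hunstable (hstab ▸ EReal.coe_ne_top _) ?_,
    hstab.trans hbar.symm, hbar⟩
  exact fun η hη hne => hstab ▸ Potts.stabilityLevel_lt_barrierHeight hpos.le hlt hlo hhi ha hη hne

theorem theorem4p4 (q K L : ℕ) (h : ℝ) (hq : 2 < q) (hpos : 0 < h) (hlt : h < 1)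
    (hint : ∀ n : ℤ, 2 / h ≠ (n : ℝ))
    (hK : 3 * Potts.criticalLength h ≤ K) (hKL : K ≤ L) :
    Landscape.metastableStates (Potts.energy K L q h) (Potts.connectivity K L q)
        = {Potts.allOne K L q hq} ∧
    Landscape.stabilityLevel (Potts.energy K L q h) (Potts.connectivity K L q)
        (Potts.allOne K L q hq)
      = Landscape.barrier (Potts.energy K L q h) (Potts.connectivity K L q)
          (Potts.allOne K L q hq) (Landscape.stableStates (Potts.energy K L q h)) ∧
    Landscape.barrier (Potts.energy K L q h) (Potts.connectivity K L q)
        (Potts.allOne K L q hq) (Landscape.stableStates (Potts.energy K L q h))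
      = ((4 * (Potts.criticalLength h : ℝ)
          - h * ((Potts.criticalLength h : ℝ) * ((Potts.criticalLength h : ℝ) - 1) + 1) : ℝ)
          : EReal) :=
  theorem4p4_general hq.le hpos (by linarith) hK (hK.trans hKL) rfl
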